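/- **Setting.** Let $(T,\mathfrak n)$ be a regular local ring with $\ell=\dim T\ge 3$, let $X_1,\dots,X_\ell$ be a regular system of parameters of $T$, and let $\mathfrak a\subseteq\mathfrak n^2$ be an ideal. Suppose that $R=T/\mathfrak a$ is a Cohen–Macaulay local ring with $\dim R=1$ which is not Gorenstein; let $\mathfrak m$ be its maximal ideal, $\mathrm Q(R)$ its total ring of fractions, $\overline R$ the integral closure of $R$ in $\mathrm Q(R)$, and $r=\mathrm r(R)$ its Cohen–Macaulay type. Let $K$ be a fractional canonical ideal of $R$, i.e. an $R$-submodule of $\mathrm Q(R)$ with $R\subseteq K\subseteq\overline R$ which is isomorphic to the canonical module $\mathrm K_R$, and put $\mathfrak c=R:R[K]=\{x\in \mathrm Q(R)\mid xR[K]\subseteq R\}$. Let $n\ge 2$, and let $\ell_1,\dots,\ell_{n-1}\ge 0$ and $\ell_n>0$ be integers with $\sum_{k=1}^n\ell_k=r-1$. For $1\le k\le n$ put $$Z^{(k)}_1=X_1^k,\qquad Z^{(k)}_j=X_j\ (2\le j\le\ell),\qquad J_k=(X_1^k,X_2,\dots,X_\ell)\subseteq T .$$ **Definition.** Let $A$ be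 a Cohen–Macaulay local ring with $d=\dim A>0$ and maximal ideal $\mathfrak m_A$, which has a canonical ideal $I$, i.e. an ideal $I\ne A$ isomorphic to $\mathrm K_A$. Then $A$ is an *$n$-Goto ring* if there is a parameter ideal $Q=(a_1,\dots,a_d)$ of $A$ with $a_1\in I$ such that, for $J=I+Q$ and the Rees algebras $\mathcal T=A[Qt]\subseteq\mathcal R=A[Jt]$, the Sally module $\mathcal S_Q(J)=J\mathcal R/J\mathcal T$ is generated over $\mathcal T$ by its homogeneous component of degree one and has rank $n$, i.e. its localization at the prime ideal $\mathfrak m_A\mathcal T$ has length $n$ over $\mathcal T_{\mathfrak m_A\mathcal T}$. **Theorem.** Suppose that there are elements $f_{ki}\in K$ $(1\le k\le n,\ 1\le i\le\ell_k)$, elements $a^{(k)}_{ij}\in T$ $(1\le k\le n,\ 1\le i\le \ell_k,\ 1\le j\le\ell)$ and $c_1,\dots,c_q\in T$ $(q\ge0)$ such that the $T$-module $K$ has a minimal free presentation $$F_1\overset{\mathbb M}{\longrightarrow}F_0\overset{\mathbb N}{\longrightarrow}K\longrightarrow0$$ of the following form. $F_0$ is free with basis $e_0$ and $e_{ki}$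 $(1\le k\le n,\ 1\le i\le\ell_k)$, and $\mathbb N(e_0)=-1$, $\mathbb N(e_{ki})=f_{ki}$. The columns of $\mathbb M$ are $$a^{(k)}_{ij}e_0+Z^{(k)}_j e_{ki}\quad(1\le k\le n,\ 1\le i\le\ell_k,\ 1\le j\le\ell)\qquad\text{and}\qquad c_s e_0\quad(1\le s\le q).$$ Suppose moreover that * $a^{(n)}_{ij}\in J_n$ for $1\le i\le\ell_n$, $1\le j\le\ell$; * $a^{(k)}_{ij}\in J_n$ for $1\le k<n$, $1\le i\le\ell_k$, $2\le j\le\ell$; * $a^{(k)}_{i1}\in J_k$ for $1\le k<n$, $1\le i\le\ell_k$. Then $R$ is an $n$-Goto ring, and $v(R/\mathfrak c)=1$, i.e. the maximal ideal of the local ring $R/\mathfrak c$ is minimally generated by one element. -/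

import Mathlib

open IsLocalRing Polynomial

universe u

noncomputable section

namespace GotoRing

/-! ### Cohen-Macaulay and Gorenstein local rings, canonical modules -/

section LocalRings

variable (A : Type u) [CommRing A] [IsLocalRing A]

/-- A Noetherian local ring is Cohen-Macaulay if its maximal ideal contains a regular sequence whose
length is the Krull dimension. -/
def IsCohenMacaulayLocal : Prop :=
  IsNoetherianRing A ∧ ∃ rs : List A, (∀ x ∈ rs, x ∈ maximalIdeal A) ∧
    RingTheory.Sequence.IsRegular A rs ∧ (rs.length : WithBot ℕ∞) = ringKrullDim A

/-- A Noetherian local ring is Gorenstein if it has finite injective dimension over itself. -/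
def IsGorensteinLocal : Prop :=
  IsNoetherianRing A ∧
    ∃ n : ℕ, CategoryTheory.HasInjectiveDimensionLE (ModuleCat.of A A) n

/-- The length over `A` of `Ext^i_A(A/𝔪, C)`, i.e. its dimension over the residue field. -/
def bassNumber (C : Type u) [AddCommGroup C] [Module A C] (i : ℕ) : ℕ∞ :=
  Module.length A (CategoryTheory.Abelian.Ext
    (ModuleCat.of A (ResidueField A)) (ModuleCat.of A C) i)

/-- `C` is a canonical module of the Cohen-Macaulay local ring `A` of dimension `d`: it is finitely
generated, and `Ext^i_A(A/𝔪, C)` is zero for `i ≠ d` and isomorphic to `A/𝔪` for `i = d`.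
(Equivalently: maximal Cohen-Macaulay, of type one and of finite injective dimension.) -/
def IsCanonicalModule (C : Type u) [AddCommGroup C] [Module A C] : Prop :=
  Module.Finite A C ∧ ∃ d : ℕ, ringKrullDim A = d ∧
    bassNumber A C d = 1 ∧ ∀ i : ℕ, i ≠ d → bassNumber A C i = 0

/-- The Cohen-Macaulay local ring `A` has Cohen-Macaulay type `r`: with `d = dim A`, the length of
`Ext^d_A(A/𝔪, A)` is `r`. -/
def HasCMType (r : ℕ) : Prop :=
  ∃ d : ℕ, ringKrullDim A = d ∧ bassNumber A A d = r

/-- The embedding dimension `v(A) = μ_A(𝔪)`. -/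
def embeddingDim : ℕ := (maximalIdeal A).spanFinrank

variable {A}

/-- A canonical ideal: a proper ideal which is a canonical module. -/
def IsCanonicalIdeal (I : Ideal A) : Prop :=
  I ≠ ⊤ ∧ IsCanonicalModule A I

/-- `a` is a system of parameters of `A`, i.e. it consists of `dim A` elements and generates an
`𝔪`-primary ideal. -/
def IsSystemOfParameters {d : ℕ} (a : Fin d → A) : Prop :=
  ringKrullDim A = d ∧ (Ideal.span (Set.range a)).radical = maximalIdeal A

end LocalRings

/-! ### Sally modules -/

section Subquotient

variable {S M : Type u} [CommRing S] [AddCommGroup M] [Module S M]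

/-- The quotient `P / N` of submodules `N ⊆ P` of a module. -/
def Subquotient (P N : Submodule S M) : Type u := P ⧸ N.submoduleOf P

instance (P N : Submodule S M) : AddCommGroup (Subquotient P N) :=
  inferInstanceAs (AddCommGroup (P ⧸ N.submoduleOf P))

instance (P N : Submodule S M) : Module S (Subquotient P N) :=
  inferInstanceAs (Module S (P ⧸ N.submoduleOf P))

/-- The canonical map `P → P / N`. -/
def Subquotient.mk (P N : Submodule S M) : P →ₗ[S] Subquotient P N :=
  (N.submoduleOf P).mkQ

end Subquotient

section Sally

variable {A : Type u} [CommRing A]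

/-- `J𝓡(L)`, the extension of the ideal `J` to the Rees algebra `𝓡(L) = A[Lt] ⊆ A[t]`,
seen as an `𝓡(Q)`-submodule of `A[t]` (it is used for `Q ⊆ L`). -/
def extRees (Q J L : Ideal A) : Submodule (reesAlgebra Q) A[X] :=
  Submodule.span (reesAlgebra Q) {f : A[X] | ∃ x ∈ J, ∃ g ∈ reesAlgebra L, f = C x * g}

/-- The Sally module `𝓢_Q(J) = J𝓡(J) / J𝓡(Q)` (with `Q ⊆ J`), as a module over `𝓡(Q)`. -/
abbrev SallyModule (Q J : Ideal A) : Type u :=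
  Subquotient (extRees Q J J) (extRees Q J Q)

/-- `𝓢_Q(J)` is generated over `𝓡(Q)` by its homogeneous component of degree one, i.e. by
the classes of the elements of `J𝓡(J)` of the form `x t`. -/
def SallyGeneratedInDegreeOne (Q J : Ideal A) : Prop :=
  Submodule.span (reesAlgebra Q)
    {s : SallyModule Q J | ∃ f : extRees Q J J,
      (∃ x : A, (f : A[X]) = monomial 1 x) ∧ s = Subquotient.mk (extRees Q J J) (extRees Q J Q) f} = ⊤

/-- `rank 𝓢_Q(J) = n`: the ideal `𝔭 = 𝔪𝓡(Q)` of `𝓡(Q)` is prime, and the localization of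
`𝓢_Q(J)` at `𝔭` has length `n`. -/
def SallyRankEq [IsLocalRing A] (Q J : Ideal A) (n : ℕ) : Prop :=
  ∃ (p : Ideal (reesAlgebra Q)) (_ : p.IsPrime),
    p = (maximalIdeal A).map (algebraMap A (reesAlgebra Q)) ∧
    Module.length (Localization.AtPrime p) (LocalizedModule p.primeCompl (SallyModule Q J)) = n

end Sally

/-! ### Goto rings -/

section Goto

variable (A : Type u) [CommRing A] [IsLocalRing A]

/-- `A` is `n`-Goto relative to the canonical ideal `I`: there is a parameter ideal
`Q = (a_1, …, a_d)`, `d = dim A > 0`, with `a_1 ∈ I`, such that for `J = I + Q` the Sally module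
`𝓢_Q(J)` has rank `n` and is generated in degree one. -/
def IsGotoRelativeTo (n : ℕ) (I : Ideal A) : Prop :=
  ∃ (e : ℕ) (a : Fin (e + 1) → A), IsSystemOfParameters a ∧ a 0 ∈ I ∧
    SallyRankEq (Ideal.span (Set.range a)) (I ⊔ Ideal.span (Set.range a)) n ∧
    SallyGeneratedInDegreeOne (Ideal.span (Set.range a)) (I ⊔ Ideal.span (Set.range a))

/-- `A` is an `n`-Goto ring: a Cohen-Macaulay local ring (of positive dimension) which admits
a canonical ideal, and which is `n`-Goto relative to an arbitrary choice of the
canonical ideal. -/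
def IsGotoRing (n : ℕ) : Prop :=
  IsCohenMacaulayLocal A ∧ (∃ I : Ideal A, IsCanonicalIdeal I) ∧
    ∀ I : Ideal A, IsCanonicalIdeal I → IsGotoRelativeTo A n I

/-- A fractional canonical ideal of `A`: an `A`-submodule `K` of the total ring of fractions `Q(A)`
with `A ⊆ K ⊆ Ā` which is a canonical module, where `Ā` is the integral closure
of `A` in `Q(A)`. -/
def IsFractionalCanonicalIdeal (K : Submodule A (FractionRing A)) : Prop :=
  1 ≤ K ∧ K ≤ Subalgebra.toSubmodule (integralClosure A (FractionRing A)) ∧ IsCanonicalModule A K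

variable {A}

/-- The ideal `𝔠 = A : A[K] = {x ∈ Q(A) | x A[K] ⊆ A}`. It is contained in `A`, because
`1 ∈ A[K]`, and it is taken here as an ideal of `A`. -/
def conductorOf (K : Submodule A (FractionRing A)) : Ideal A :=
  ((1 : Submodule A (FractionRing A)) /
    Subalgebra.toSubmodule (Algebra.adjoin A (K : Set (FractionRing A)))).comap
      (Algebra.linearMap A (FractionRing A))

end Goto

/-! ### Minimal free presentations -/

section Presentations

variable {T : Type u} [CommRing T]

/-- The sequence `T^n --M--> T^m --g--> V → 0`, in which `g` sends the basis vector `e_i` to `g i`,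
is a minimal free presentation of the `T`-module `V`: it is exact, `Ker g ⊆ 𝔫 T^m` and
`Ker M ⊆ 𝔫 T^n`. -/
structure IsMinimalFreePresentation [IsLocalRing T] {V : Type*} [AddCommGroup V] [Module T V]
    {m n : Type*} [Fintype m] [Fintype n] (M : Matrix m n T) (g : m → V) : Prop where
  surjective : Function.Surjective (Fintype.linearCombination T g)
  exact : Function.Exact M.mulVecLin (Fintype.linearCombination T g)
  minimal_zero : ∀ v : m → T, Fintype.linearCombination T g v = 0 → ∀ i, v i ∈ maximalIdeal T
  minimal_one : ∀ w : n → T, M.mulVecLin w = 0 → ∀ j, w j ∈ maximalIdeal T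

/-- The sequence `X_1^k, X_2, …, X_d`. -/
def powFirst {d : ℕ} (X : Fin d → T) (k : ℕ) (j : Fin d) : T :=
  if (j : ℕ) = 0 then X j ^ k else X j

/-- The ideal `J_k = (X_1^k, X_2, …, X_d)`. -/
def idealJ {d : ℕ} (X : Fin d → T) (k : ℕ) : Ideal T :=
  Ideal.span (Set.range (powFirst X k))

/-- The labels `(k, i)` of the blocks: for each exponent `k + 1 ∈ {1, …, n}` there are `l k` blocks
(where `k : Fin n`), which are numbered by `i`. -/
abbrev BlockIndex {n : ℕ} (l : Fin n → ℕ) : Type := Σ k : Fin n, Fin (l k)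

/-- The block matrix `𝕄`. Its rows are labelled by `none` (the first row) and by the blocks; its
columns by the pairs of a block and a `j ∈ {1, …, d}`, and by `{1, …, q}`.
The first row consists of the entries `a_{ij}^{(k)}` and `c_1, …, c_q`; the row of a block
`(k, i)` has `X_1^{k+1}, X_2, …, X_d` in the columns of that block, and zeros elsewhere. -/
def blockMatrix {d n q : ℕ} (X : Fin d → T) {l : Fin n → ℕ}
    (a : BlockIndex l → Fin d → T) (c : Fin q → T) :
    Matrix (Option (BlockIndex l)) ((BlockIndex l × Fin d) ⊕ Fin q) T
  | none, Sum.inl (b, j) => a b j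
  | none, Sum.inr s => c s
  | some b, Sum.inl (b', j) => if b = b' then powFirst X (b.1 + 1) j else 0
  | some _, Sum.inr _ => 0

/-- The row `ℕ = [-1 f_{n1} ⋯ f_{1ℓ_1}]`, with entries in `K`. -/
def blockRow {R : Type u} [CommRing R] {K : Submodule R (FractionRing R)} (hK : 1 ≤ K)
    {n : ℕ} {l : Fin n → ℕ} (f : BlockIndex l → K) : Option (BlockIndex l) → K
  | none => -⟨1, Submodule.one_le.mp hK⟩
  | some b => f b

end Presentations

end GotoRing

end

/-! Throughout, `M / N` for submodules of Q(R) is the colon module M : N. A column of 𝕄 belonging to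
the block (k,i) is a relation Z_j f_{ki} = a_{ij} in Q(R); conversely, exactness says that t f_{ki}
∈ R forces t ∈ J_k. The conditions on the a_{ij} give J_n K ⊆ J_n R, and a block of exponent n,
which exists because ℓ_n > 0, gives R : K ⊆ J_n R. So R : K = J_n R (`one_div_eq`). This ideal is
stable under multiplication by K, hence it equals the conductor 𝔠. Since 𝔞 ⊆ J_n, the ring R/𝔠 is
T/J_n: its maximal ideal is generated by the image of X_1, whose n-th power is the first to vanish.
Therefore ℓ(R/𝔠) = n, and v(R/𝔠) = 1 because n ≥ 2.

The duality M ↦ K : M is reflexive and preserves lengths of quotients (`div_div_self`,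
`length_div_quotient`). From K : K = R, K : K² = R : K = 𝔠 and K : K³ = 𝔠 : K = 𝔠 it follows that K³
= K² and ℓ(K²/K) = ℓ(R/𝔠) = n (`mul_mul_self_eq_and_length`).

Canonical modules inside Q(R) are unique up to a unit (`exists_unit_of_isCanonicalModule`), so every
canonical ideal I equals xK with x ∈ I regular. Then I³ = xI², and the Sally module of I with
respect to (x) is I²/xI ≅ K²/K extended to the Rees algebra of (x), a polynomial ring over R. It is
thus generated in degree one and has rank n (`isGotoRelativeTo_of_fractional`). The duality itself
is derived from the Bass numbers 0, 1, 0 of a canonical module in degrees 0, 1, 2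
(`length_ext_one`). -/

noncomputable section

namespace GotoRing

/-! ### Ext into a module whose Bass numbers begin with 0, 1, 0. -/

section ExtLength

open CategoryTheory Abelian

variable {A : Type u} [CommRing A]

/-- The short complex of modules given by two linear maps which form an exact sequence. -/
abbrev shortComplexOfExact {M N P : Type u} [AddCommGroup M] [AddCommGroup N] [AddCommGroup P]
    [Module A M] [Module A N] [Module A P] (f : M →ₗ[A] N) (g : N →ₗ[A] P)
    (h : Function.Exact f g) : ShortComplex (ModuleCat.{u} A) :=
  ShortComplex.mk (ModuleCat.ofHom f) (ModuleCat.ofHom g)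
    (by rw [← ModuleCat.ofHom_comp, h.linearMap_comp_eq_zero]; rfl)

lemma shortExact_shortComplexOfExact {M N P : Type u} [AddCommGroup M] [AddCommGroup N]
    [AddCommGroup P] [Module A M] [Module A N] [Module A P] (f : M →ₗ[A] N) (g : N →ₗ[A] P)
    (h : Function.Exact f g) (hf : Function.Injective f) (hg : Function.Surjective g) :
    (shortComplexOfExact f g h).ShortExact where
  exact := (ShortComplex.ShortExact.moduleCat_exact_iff_function_exact _).2 h
  mono_f := (ModuleCat.mono_iff_injective _).2 hf
  epi_g := (ModuleCat.epi_iff_surjective _).2 hg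

/-- Precomposition with an extension class, as a linear map. -/
def extPrecomp {X Y : ModuleCat.{u} A} {i : ℕ} (α : Ext X Y i) (Z : ModuleCat.{u} A) {j k : ℕ}
    (h : i + j = k) : Ext Y Z j →ₗ[A] Ext X Z k where
  toFun β := α.comp β h
  map_add' := by simp
  map_smul' := by simp

/-- Postcomposition with an extension class, as a linear map. -/
def extPostcomp {Y Z : ModuleCat.{u} A} {j : ℕ} (β : Ext Y Z j) (X : ModuleCat.{u} A) {i k : ℕ}
    (h : i + j = k) : Ext X Y i →ₗ[A] Ext X Z k where
  toFun α := α.comp β h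
  map_add' := by simp
  map_smul' := by simp

/-- `Ext` is invariant under isomorphisms in the first variable. -/
def extCongrLeft {X Y : ModuleCat.{u} A} (e : X ≅ Y) (Z : ModuleCat.{u} A) (i : ℕ) :
    Ext Y Z i ≃ₗ[A] Ext X Z i :=
  LinearEquiv.ofLinearMap (extPrecomp (Ext.mk₀ e.hom) Z (zero_add i))
    (extPrecomp (Ext.mk₀ e.inv) Z (zero_add i))
    (by ext x; simp [extPrecomp]) (by ext x; simp [extPrecomp])

/-- `Ext` is invariant under isomorphisms in the second variable. -/
def extCongrRight (X : ModuleCat.{u} A) {Y Z : ModuleCat.{u} A} (e : Y ≅ Z) (i : ℕ) :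
    Ext X Y i ≃ₗ[A] Ext X Z i :=
  LinearEquiv.ofLinearMap (extPostcomp (Ext.mk₀ e.hom) X (add_zero i))
    (extPostcomp (Ext.mk₀ e.inv) X (add_zero i))
    (by ext x; simp [extPostcomp]) (by ext x; simp [extPostcomp])

lemma IsCanonicalModule.congr [IsLocalRing A] {C D : Type u} [AddCommGroup C] [Module A C]
    [AddCommGroup D] [Module A D] (e : C ≃ₗ[A] D) (h : IsCanonicalModule A C) :
    IsCanonicalModule A D := by
  have key (i : ℕ) : bassNumber A D i = bassNumber A C i :=
    (extCongrRight (ModuleCat.of A (ResidueField A)) e.toModuleIso i).length_eq.symm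
  obtain ⟨h1, d, hd, h2, h3⟩ := h
  exact ⟨Module.Finite.equiv e, d, hd, by rw [key, h2], fun i hi => by rw [key, h3 i hi]⟩

/-- If `0 → P → F → M → 0` is exact and `Ext^1(F, C) = 0`, then every element of `Ext^1(M, C)` comes
from a map `P → C`, which is unique up to the maps which extend to `F`. -/
lemma exists_linearMap_ext_one {P F M : Type u} [AddCommGroup P] [AddCommGroup F] [AddCommGroup M]
    [Module A P] [Module A F] [Module A M] (f : P →ₗ[A] F) (g : F →ₗ[A] M)
    (h : Function.Exact f g) (hf : Function.Injective f) (hg : Function.Surjective g)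
    (C : Type u) [AddCommGroup C] [Module A C]
    (hF : Subsingleton (Ext (ModuleCat.of A F) (ModuleCat.of A C) 1)) :
    ∃ δ : (P →ₗ[A] C) →ₗ[A] Ext (ModuleCat.of A M) (ModuleCat.of A C) 1,
      Function.Surjective δ ∧ ∀ φ, δ φ = 0 ↔ ∃ ψ : F →ₗ[A] C, ψ ∘ₗ f = φ := by
  have hS := shortExact_shortComplexOfExact f g h hf hg
  let δ : (P →ₗ[A] C) →ₗ[A] Ext (ModuleCat.of A M) (ModuleCat.of A C) 1 :=
    { toFun := fun φ => hS.extClass.comp (Ext.mk₀ (ModuleCat.ofHom φ)) (add_zero 1)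
      map_add' := fun φ ψ => by rw [ModuleCat.ofHom_add, Ext.mk₀_add, Ext.comp_add]
      map_smul' := fun r φ => by
        have : ModuleCat.ofHom (r • φ) = r • ModuleCat.ofHom φ := rfl
        rw [this, Ext.mk₀_smul, Ext.comp_smul]; rfl }
  refine ⟨δ, fun x => ?_, fun φ => ⟨fun hφ => ?_, ?_⟩⟩
  · obtain ⟨y, hy⟩ := Ext.contravariant_sequence_exact₃ hS (ModuleCat.of A C) x
      (hF.elim _ _) (add_zero 1)
    obtain ⟨φ, rfl⟩ := Ext.homEquiv₀.symm.surjective y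
    exact ⟨φ.hom, hy⟩
  · obtain ⟨y, hy⟩ := Ext.contravariant_sequence_exact₁ hS (ModuleCat.of A C)
      (Ext.mk₀ (ModuleCat.ofHom φ)) (add_zero 1) hφ
    obtain ⟨ψ, rfl⟩ := Ext.homEquiv₀.symm.surjective y
    refine ⟨ψ.hom, ?_⟩
    have hy' := hy
    change (Ext.mk₀ _).comp (Ext.mk₀ ψ) _ = _ at hy'
    rw [Ext.mk₀_comp_mk₀] at hy'
    have := (Ext.mk₀_bijective _ _).1 hy'
    simpa using congrArg ModuleCat.Hom.hom this
  · rintro ⟨ψ, rfl⟩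
    change hS.extClass.comp (Ext.mk₀ (ModuleCat.ofHom (ψ ∘ₗ f))) (add_zero 1) = 0
    rw [ModuleCat.ofHom_comp, ← Ext.mk₀_comp_mk₀]
    exact hS.extClass_comp_assoc _

/-- The vanishing of Ext⁰(M, C) and Ext²(P, C) cuts a short exact sequence of Ext¹ out of the long
one. This is the inductive step for `length_ext_one`. -/
lemma length_ext_of_exact {M N P : Type u} [AddCommGroup M] [AddCommGroup N] [AddCommGroup P]
    [Module A M] [Module A N] [Module A P] (f : M →ₗ[A] N) (g : N →ₗ[A] P)
    (h : Function.Exact f g) (hf : Function.Injective f) (hg : Function.Surjective g)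
    (C : ModuleCat.{u} A)
    (hM : Subsingleton (Ext (ModuleCat.of A M) C 0) ∧ Subsingleton (Ext (ModuleCat.of A M) C 2))
    (hP : Subsingleton (Ext (ModuleCat.of A P) C 0) ∧ Subsingleton (Ext (ModuleCat.of A P) C 2)) :
    (Subsingleton (Ext (ModuleCat.of A N) C 0) ∧ Subsingleton (Ext (ModuleCat.of A N) C 2)) ∧
      Module.length A (Ext (ModuleCat.of A N) C 1) = Module.length A (Ext (ModuleCat.of A P) C 1) +
        Module.length A (Ext (ModuleCat.of A M) C 1) := by
  have hS := shortExact_shortComplexOfExact f g h hf hg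
  obtain ⟨hM0, hM2⟩ := hM
  obtain ⟨hP0, hP2⟩ := hP
  have mid (i : ℕ) (h1 : Subsingleton (Ext (ModuleCat.of A M) C i))
      (h2 : Subsingleton (Ext (ModuleCat.of A P) C i)) :
      Subsingleton (Ext (ModuleCat.of A N) C i) := by
    refine subsingleton_of_forall_eq 0 fun x => ?_
    obtain ⟨y, hy⟩ := Ext.contravariant_sequence_exact₂ hS C x (h1.elim _ _)
    rw [← hy, h2.elim y 0]
    simp
  refine ⟨⟨mid 0 hM0 hP0, mid 2 hM2 hP2⟩, ?_⟩
  refine Module.length_eq_add_of_exact (extPrecomp (Ext.mk₀ (ModuleCat.ofHom g)) C (zero_add 1))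
    (extPrecomp (Ext.mk₀ (ModuleCat.ofHom f)) C (zero_add 1)) ?_ ?_ ?_
  · rw [← LinearMap.ker_eq_bot, LinearMap.ker_eq_bot']
    intro x hx
    obtain ⟨y, hy⟩ := Ext.contravariant_sequence_exact₃ hS C x hx (add_zero 1)
    rw [← hy, hM0.elim y 0]
    simp
  · intro x
    exact Ext.contravariant_sequence_exact₁ hS C x rfl (hP2.elim _ _)
  · intro x
    refine ⟨fun hx => Ext.contravariant_sequence_exact₂ hS C x hx, ?_⟩
    rintro ⟨y, rfl⟩
    change (Ext.mk₀ (ModuleCat.ofHom f)).comp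
      ((Ext.mk₀ (ModuleCat.ofHom g)).comp y (zero_add 1)) (zero_add 1) = 0
    rw [Ext.mk₀_comp_mk₀_assoc, ← ModuleCat.ofHom_comp, h.linearMap_comp_eq_zero]
    exact (congrArg (fun z => Ext.comp z y (zero_add 1)) (Ext.mk₀_zero _ _)).trans
      (Ext.zero_comp _ _ _ _ _)

/-- If the Bass numbers of `C` begin with `0, 1, 0`, then `Ext^i(-, C)` vanishes on modules of
finite length for `i = 0, 2`, and `Ext^1(-, C)` preserves their lengths. -/
lemma length_ext_one [IsLocalRing A] {C : Type u} [AddCommGroup C] [Module A C]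
    (h0 : bassNumber A C 0 = 0) (h1 : bassNumber A C 1 = 1) (h2 : bassNumber A C 2 = 0)
    {M : Type u} [AddCommGroup M] [Module A M] (hM : IsFiniteLength A M) :
    (Subsingleton (Ext (ModuleCat.of A M) (ModuleCat.of A C) 0) ∧
      Subsingleton (Ext (ModuleCat.of A M) (ModuleCat.of A C) 2)) ∧
      Module.length A (Ext (ModuleCat.of A M) (ModuleCat.of A C) 1) = Module.length A M := by
  induction hM with
  | @of_subsingleton M _ _ _ =>
    have hz (i : ℕ) : Subsingleton (Ext (ModuleCat.of A M) (ModuleCat.of A C) i) := by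
      refine subsingleton_of_forall_eq 0 fun x => ?_
      rw [← Ext.mk₀_id_comp x]
      have : 𝟙 (ModuleCat.of A M) = 0 := by
        ext y
        exact Subsingleton.elim (α := M) _ _
      rw [this, Ext.mk₀_zero, Ext.zero_comp]
    refine ⟨⟨hz 0, hz 2⟩, ?_⟩
    have := hz 1
    rw [Module.length_eq_zero, Module.length_eq_zero]
  | @of_simple_quotient M _ _ N hsimple _ ih =>
    -- Over a local ring the simple quotient is the residue field, whose Ext modules are measured by
    -- the Bass numbers.
    obtain ⟨I, hI, ⟨e⟩⟩ := isSimpleModule_iff_quot_maximal.1 hsimple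
    obtain rfl := IsLocalRing.eq_maximalIdeal hI
    have e' (i : ℕ) := extCongrLeft (LinearEquiv.toModuleIso
      (show (M ⧸ N) ≃ₗ[A] ResidueField A from e)) (ModuleCat.of A C) i
    have key := length_ext_of_exact N.subtype N.mkQ (LinearMap.exact_subtype_mkQ N)
      N.injective_subtype N.mkQ_surjective (ModuleCat.of A C) ih.1
      ⟨Module.length_eq_zero_iff.1 ((e' 0).length_eq.symm.trans h0),
        Module.length_eq_zero_iff.1 ((e' 2).length_eq.symm.trans h2)⟩
    refine ⟨key.1, ?_⟩
    rw [key.2, ih.2, Module.length_eq_add_of_exact N.subtype N.mkQ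
      N.injective_subtype N.mkQ_surjective (LinearMap.exact_subtype_mkQ N), add_comm,
      Module.length_eq_one A (M ⧸ N)]
    congr 1
    exact (e' 1).length_eq.symm.trans h1

/-- If the Bass numbers of `C` begin with `0, 1, 0`, then an element which kills `C` kills every
module of finite length. -/
lemma smul_eq_zero_of_smul_eq_zero [IsLocalRing A] {C : Type u} [AddCommGroup C] [Module A C]
    (h0 : bassNumber A C 0 = 0) (h1 : bassNumber A C 1 = 1) (h2 : bassNumber A C 2 = 0)
    {r : A} (hr : ∀ y : C, r • y = 0)
    {M : Type u} [AddCommGroup M] [Module A M] (hM : IsFiniteLength A M) (y : M) : r • y = 0 := by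
  let ρ : M →ₗ[A] M := LinearMap.lsmul A M r
  let N : Submodule A M := LinearMap.range ρ
  have hN : IsFiniteLength A N := hM.of_injective N.injective_subtype
  have hS := shortExact_shortComplexOfExact N.subtype N.mkQ (LinearMap.exact_subtype_mkQ N)
    N.injective_subtype N.mkQ_surjective
  have hT := shortExact_shortComplexOfExact (LinearMap.ker ρ).subtype ρ.rangeRestrict
    (by rw [LinearMap.exact_iff, LinearMap.ker_rangeRestrict, Submodule.range_subtype])
    (LinearMap.ker ρ).injective_subtype ρ.surjective_rangeRestrict
  have hker : IsFiniteLength A (LinearMap.ker ρ) :=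
    hM.of_injective (LinearMap.ker ρ).injective_subtype
  have hquot : IsFiniteLength A (M ⧸ N) := hM.of_surjective N.mkQ_surjective
  -- Multiplication by r factors as M ↠ N ↪ M. The map Ext¹(M, C) → Ext¹(N, C) is onto since
  -- Ext²(M/N, C) = 0, and Ext¹(N, C) → Ext¹(M, C) is injective since Hom(ker ρ, C) = 0. Their
  -- composite is multiplication by r, which is zero because r kills C.
  have hext : Subsingleton (Ext (ModuleCat.of A N) (ModuleCat.of A C) 1) := by
    refine subsingleton_of_forall_eq 0 fun x => ?_
    obtain ⟨z, rfl⟩ := Ext.contravariant_sequence_exact₁ hS (ModuleCat.of A C) x rfl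
      ((length_ext_one h0 h1 h2 hquot).1.2.elim _ _)
    have hz : r • z = 0 := by
      rw [Ext.smul_eq_comp_mk₀]
      have : r • 𝟙 (ModuleCat.of A C) = 0 := by
        ext y
        exact hr y
      rw [this, Ext.mk₀_zero, Ext.comp_zero]
    have hz' : (Ext.mk₀ (ModuleCat.ofHom ρ.rangeRestrict)).comp
        ((Ext.mk₀ (ModuleCat.ofHom N.subtype)).comp z (zero_add 1)) (zero_add 1) = 0 := by
      rw [Ext.mk₀_comp_mk₀_assoc, ← ModuleCat.ofHom_comp, ← hz]
      have : ModuleCat.ofHom (N.subtype ∘ₗ ρ.rangeRestrict) = r • 𝟙 (ModuleCat.of A M) := rfl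
      rw [this, Ext.mk₀_smul, Ext.smul_comp, Ext.mk₀_id_comp]
    obtain ⟨w, hw⟩ := Ext.contravariant_sequence_exact₃ hT (ModuleCat.of A C) _ hz' (add_zero 1)
    refine hw.symm.trans ?_
    rw [(length_ext_one h0 h1 h2 hker).1.1.elim w 0, Ext.comp_zero]
  have := (length_ext_one h0 h1 h2 hN).2
  rw [Module.length_eq_zero] at this
  have := Module.length_eq_zero_iff.1 this.symm
  exact congrArg Subtype.val (this.elim (⟨ρ y, y, rfl⟩ : N) 0)

/-- If `Ext^2(A/N, C) = 0` then `Ext^1(N, C) = 0`. -/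
lemma subsingleton_ext_one_ideal (N : Ideal A) (C : ModuleCat.{u} A)
    (h : Subsingleton (Ext (ModuleCat.of A (A ⧸ N)) C 2)) :
    Subsingleton (Ext (ModuleCat.of A N) C 1) := by
  have hS := shortExact_shortComplexOfExact N.subtype N.mkQ (LinearMap.exact_subtype_mkQ N)
    N.injective_subtype N.mkQ_surjective
  have : Projective (ModuleCat.of A A) := (IsProjective.iff_projective (R := A) A).1 inferInstance
  refine subsingleton_of_forall_eq 0 fun x => ?_
  obtain ⟨z, rfl⟩ := Ext.contravariant_sequence_exact₁ hS C x rfl (h.elim _ _)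
  have hz : z = 0 := Ext.eq_zero_of_projective (P := ModuleCat.of A A) z
  rw [hz, Ext.comp_zero]

end ExtLength

/-! ### Finite length and parameters in dimension one. -/

section FiniteLength

variable {A : Type u} [CommRing A]

lemma krullDimLE_zero_quotient_span (hdim : ringKrullDim A = 1) {s : A}
    (hs : s ∈ nonZeroDivisors A) : Ring.KrullDimLE 0 (A ⧸ Ideal.span {s}) := by
  have h := ringKrullDim_quotient_succ_le_of_nonZeroDivisor hs
  rw [hdim] at h
  rw [Ring.krullDimLE_iff]
  rcases h' : ringKrullDim (A ⧸ Ideal.span {s}) with _ | _ | m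
  · exact bot_le
  · rw [h'] at h
    exact absurd h (by decide)
  · rw [h'] at h
    change ((m + 1 : ℕ) : WithBot ℕ∞) ≤ ((1 : ℕ) : WithBot ℕ∞) at h
    change ((m : ℕ) : WithBot ℕ∞) ≤ ((0 : ℕ) : WithBot ℕ∞)
    norm_cast at h ⊢
    omega

/-- In a one-dimensional Noetherian ring, the quotient by an ideal which contains
a non-zero-divisor has finite length. -/
lemma isFiniteLength_quotient [IsNoetherianRing A] (hdim : ringKrullDim A = 1) {N : Ideal A} {s : A}
    (hs : s ∈ nonZeroDivisors A) (hsN : s ∈ N) : IsFiniteLength A (A ⧸ N) := by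
  have := krullDimLE_zero_quotient_span hdim hs
  have h1 : IsArtinianRing (A ⧸ Ideal.span {s}) :=
    IsNoetherianRing.isArtinianRing_of_krullDimLE_zero
  have h2 : IsArtinian A (A ⧸ Ideal.span {s}) :=
    isArtinian_of_surjective_algebraMap (R := A ⧸ Ideal.span {s}) Ideal.Quotient.mk_surjective
  have h3 : IsFiniteLength A (A ⧸ Ideal.span {s}) :=
    isFiniteLength_iff_isNoetherian_isArtinian.2 ⟨inferInstance, h2⟩
  have hle : Ideal.span {s} ≤ N := (Ideal.span_singleton_le_iff_mem N).2 hsN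
  exact h3.of_surjective (f := Submodule.factor hle) (Submodule.factor_surjective hle)

lemma radical_span_singleton [IsLocalRing A] (hdim : ringKrullDim A = 1) {s : A}
    (hs : s ∈ nonZeroDivisors A) (hsm : s ∈ maximalIdeal A) :
    (Ideal.span {s}).radical = maximalIdeal A := by
  have := krullDimLE_zero_quotient_span hdim hs
  apply le_antisymm
  · rw [(maximalIdeal.isMaximal A).isPrime.radical_le_iff]
    exact (Ideal.span_singleton_le_iff_mem _).2 hsm
  -- The quotient by s is zero-dimensional, so each prime containing s is maximal.
  · rw [Ideal.radical_eq_sInf]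
    refine le_sInf ?_
    rintro J ⟨hJ, hJp⟩
    have : (J.map (Ideal.Quotient.mk (Ideal.span {s}))).IsPrime :=
      Ideal.map_isPrime_of_surjective Ideal.Quotient.mk_surjective (by simpa using hJ)
    have hmax := Ideal.isMaximal_of_isPrime (J.map (Ideal.Quotient.mk (Ideal.span {s})))
    have h2 := Ideal.comap_isMaximal_of_surjective (Ideal.Quotient.mk (Ideal.span {s}))
      Ideal.Quotient.mk_surjective (K := J.map (Ideal.Quotient.mk (Ideal.span {s})))
    rw [Ideal.comap_map_of_surjective _ Ideal.Quotient.mk_surjective, ← RingHom.ker_eq_comap_bot,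
      Ideal.mk_ker, sup_eq_left.2 hJ] at h2
    rw [IsLocalRing.eq_maximalIdeal h2]

end FiniteLength

/-! ### Canonical duality for regular fractional modules. -/

section Duality

open scoped nonZeroDivisors
open CategoryTheory Abelian

variable {A : Type u} [CommRing A] {Q : Type u} [CommRing Q] [Algebra A Q]

lemma IsCanonicalModule.bassNumber_eq [IsLocalRing A] (hdim : ringKrullDim A = 1) {C : Type u}
    [AddCommGroup C] [Module A C] (hC : IsCanonicalModule A C) :
    bassNumber A C 0 = 0 ∧ bassNumber A C 1 = 1 ∧ bassNumber A C 2 = 0 := by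
  obtain ⟨-, d, hd, h1, h2⟩ := hC
  rw [hdim] at hd
  obtain rfl : 1 = d := by exact_mod_cast hd
  exact ⟨h2 0 (by decide), h1, h2 2 (by decide)⟩

/-- A submodule `M` of the total ring of fractions which has a regular common denominator and
contains a non-zero-divisor of the ring. -/
def IsRegularFractional (M : Submodule A Q) : Prop :=
  (∃ a ∈ A⁰, ∀ y ∈ M, a • y ∈ (1 : Submodule A Q)) ∧ ∃ b ∈ A⁰, algebraMap A Q b ∈ M

lemma IsRegularFractional.one : IsRegularFractional (1 : Submodule A Q) :=
  ⟨⟨1, one_mem _, fun y hy => by simpa using hy⟩, 1, one_mem _,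
    by rw [map_one]; exact Submodule.one_le.1 le_rfl⟩

lemma IsRegularFractional.mul {M N : Submodule A Q} (hM : IsRegularFractional M)
    (hN : IsRegularFractional N) : IsRegularFractional (M * N) := by
  obtain ⟨⟨a, ha, ha'⟩, b, hb, hb'⟩ := hM
  obtain ⟨⟨c, hc, hc'⟩, e, he, he'⟩ := hN
  refine ⟨⟨a * c, mul_mem ha hc, fun y hy => ?_⟩, b * e, mul_mem hb he, ?_⟩
  · refine Submodule.mul_induction_on hy (fun m hm n hn => ?_) (fun x y hx hy => ?_)
    · have := Submodule.mul_mem_mul (ha' m hm) (hc' n hn)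
      rwa [one_mul, smul_mul_smul_comm] at this
    · rw [smul_add]
      exact add_mem hx hy
  · rw [map_mul]
    exact Submodule.mul_mem_mul hb' he'

/-- A denominator of M times a regular element of N clears M : N, and a regular element of M times a
denominator of N lies in M : N. -/
lemma IsRegularFractional.div {M N : Submodule A Q} (hM : IsRegularFractional M)
    (hN : IsRegularFractional N) : IsRegularFractional (M / N) := by
  obtain ⟨⟨a, ha, ha'⟩, b, hb, hb'⟩ := hM
  obtain ⟨⟨c, hc, hc'⟩, e, he, he'⟩ := hN
  refine ⟨⟨a * e, mul_mem ha he, fun y hy => ?_⟩, b * c, mul_mem hb hc, ?_⟩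
  · have := ha' _ (Submodule.mem_div_iff_forall_mul_mem.1 hy _ he')
    rwa [mul_comm y, ← Algebra.smul_def, smul_smul] at this
  · rw [Submodule.mem_div_iff_forall_mul_mem]
    intro y hy
    obtain ⟨z, hz⟩ := Submodule.mem_one.1 (hc' y hy)
    rw [map_mul, mul_assoc, ← Algebra.smul_def c, ← hz, mul_comm, ← Algebra.smul_def]
    exact M.smul_mem _ hb'

lemma IsRegularFractional.mono {M N : Submodule A Q} (hM : IsRegularFractional M)
    (hMN : M ≤ N) {L : Submodule A Q} (hL : IsRegularFractional L) (hNL : N ≤ L) :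
    IsRegularFractional N := by
  obtain ⟨b, hb, hb'⟩ := hM.2
  obtain ⟨a, ha, ha'⟩ := hL.1
  exact ⟨⟨a, ha, fun y hy => ha' y (hNL hy)⟩, b, hb, hMN hb'⟩

/-- The extension of an ideal `N` to `Q`, as a submodule. -/
abbrev fracIdeal (Q : Type u) [CommRing Q] [Algebra A Q] (N : Ideal A) : Submodule A Q :=
  Submodule.map (Algebra.linearMap A Q) N

lemma IsRegularFractional.fracIdeal {N : Ideal A} {s : A} (hs : s ∈ A⁰) (hsN : s ∈ N) :
    IsRegularFractional (fracIdeal Q N) := by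
  refine ⟨⟨1, one_mem _, ?_⟩, s, hs, s, hsN, rfl⟩
  rintro _ ⟨t, -, rfl⟩
  simp

lemma le_div_div (C M : Submodule A Q) : M ≤ C / (C / M) := by
  rw [Submodule.le_div_iff]
  intro x hx z hz
  rw [mul_comm]
  exact Submodule.mem_div_iff_forall_mul_mem.1 hz x hx

lemma div_le_div_left {C M N : Submodule A Q} (h : M ≤ N) : C / N ≤ C / M := fun _ hx =>
  Submodule.mem_div_iff_forall_mul_mem.2 fun y hy =>
    Submodule.mem_div_iff_forall_mul_mem.1 hx y (h hy)

variable [IsFractionRing A Q]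

lemma isUnit_algebraMap_of_mem {b : A} (hb : b ∈ A⁰) : IsUnit (algebraMap A Q b) :=
  IsLocalization.map_units Q ⟨b, hb⟩

/-- A fractional submodule is isomorphic to an ideal. -/
lemma IsRegularFractional.exists_linearMap {M : Submodule A Q} (hM : IsRegularFractional M) :
    ∃ a ∈ A⁰, ∃ f : M →ₗ[A] A, Function.Injective f ∧
      ∀ y : M, algebraMap A Q (f y) = algebraMap A Q a * y := by
  obtain ⟨⟨a, ha, ha'⟩, -⟩ := hM
  have hinj : Function.Injective (Algebra.linearMap A Q) := IsFractionRing.injective A Q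
  have hr (y : M) : a • (y : Q) ∈ LinearMap.range (Algebra.linearMap A Q) := by
    rw [← Submodule.one_eq_range]
    exact ha' y y.2
  let g : M →ₗ[A] LinearMap.range (Algebra.linearMap A Q) :=
    (a • M.subtype).codRestrict _ hr
  let e := LinearEquiv.ofInjective _ hinj
  have hf (y : M) : algebraMap A Q ((e.symm.toLinearMap ∘ₗ g) y) = algebraMap A Q a * y := by
    have : (e (e.symm (g y)) : Q) = g y := by rw [e.apply_symm_apply]
    rw [← Algebra.smul_def]
    exact this
  refine ⟨a, ha, e.symm.toLinearMap ∘ₗ g, fun y z hyz => ?_, hf⟩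
  have := hf y
  rw [hyz, hf z] at this
  exact Subtype.ext ((isUnit_algebraMap_of_mem ha).mul_left_cancel this).symm

/-- Since N contains a regular b and every y ∈ N has a regular multiple in Ab, the map φ is
determined by φ(b); take z = φ(b)/b. This identifies Hom(N, C) with C : N. -/
lemma IsRegularFractional.exists_mul_eq {N C : Submodule A Q} (hN : IsRegularFractional N)
    (φ : N →ₗ[A] C) : ∃ z : Q, ∀ y : N, (φ y : Q) = z * y := by
  obtain ⟨b, hb, hb'⟩ := hN.2
  obtain ⟨u, hu⟩ := isUnit_algebraMap_of_mem (Q := Q) hb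
  refine ⟨(↑u⁻¹ : Q) * φ ⟨_, hb'⟩, fun y => ?_⟩
  obtain ⟨⟨p, s⟩, hps⟩ := IsLocalization.surj A⁰ (y : Q)
  have hs := isUnit_algebraMap_of_mem (Q := Q) s.2
  have h1 : (s * b : A) • y = p • (⟨_, hb'⟩ : N) := by
    apply Subtype.ext
    simp only [Submodule.coe_smul, Algebra.smul_def, map_mul]
    linear_combination (algebraMap A Q b) * hps
  have h2 := congrArg (Subtype.val) (congrArg φ h1)
  simp only [map_smul, Submodule.coe_smul, Algebra.smul_def, map_mul] at h2
  apply hs.mul_left_cancel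
  apply u.isUnit.mul_left_cancel
  have h3 : (u : Q) * (↑u⁻¹ : Q) = 1 := u.mul_inv
  linear_combination h2 + (φ y : Q) * algebraMap A Q s * hu - (φ ⟨_, hb'⟩ : Q) * hps -
    (φ ⟨_, hb'⟩ : Q) * (y : Q) * algebraMap A Q s * h3

variable [IsNoetherianRing A]

/-- M embeds in A by clearing denominators, and the image of N ∩ M contains a regular element, so
the quotient embeds in a module A/(ideal) of finite length. The inclusion N ⊆ M is not needed. -/
lemma IsRegularFractional.isFiniteLength (hdim : ringKrullDim A = 1) {M N : Submodule A Q}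
    (hN : IsRegularFractional N) (hM : IsRegularFractional M) :
    IsFiniteLength A (M ⧸ N.submoduleOf M) := by
  obtain ⟨a, ha, f, hf, hfa⟩ := hM.exists_linearMap
  obtain ⟨c, hc, hc'⟩ := hM.1
  obtain ⟨b, hb, hb'⟩ := hN.2
  have hle : N.submoduleOf M ≤ ((N.submoduleOf M).map f).comap f := Submodule.le_comap_map _ _
  have hfl : IsFiniteLength A (A ⧸ ((N ⊓ M).submoduleOf M).map f) := by
    obtain ⟨e, he, he'⟩ := hM.2
    have hbM : algebraMap A Q (b * e) ∈ N ⊓ M := by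
      refine ⟨?_, ?_⟩
      · rw [map_mul, mul_comm, ← Algebra.smul_def]; exact N.smul_mem _ hb'
      · rw [map_mul, ← Algebra.smul_def]; exact M.smul_mem _ he'
    refine isFiniteLength_quotient hdim (s := a * (b * e)) (mul_mem ha (mul_mem hb he))
      ⟨⟨_, hbM.2⟩, hbM, ?_⟩
    apply IsFractionRing.injective A Q
    exact (hfa _).trans (map_mul _ _ _).symm
  have hNM : (N ⊓ M).submoduleOf M = N.submoduleOf M := by
    ext y; simp [Submodule.submoduleOf]
  rw [hNM] at hfl
  refine hfl.of_injective (f := Submodule.mapQ _ _ f hle) ?_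
  rw [← LinearMap.ker_eq_bot, Submodule.ker_mapQ, Submodule.comap_map_eq_of_injective hf,
    Submodule.mkQ_map_self]

variable [IsLocalRing A]

/-- M is isomorphic to an ideal 𝔟 with A/𝔟 of finite length, and Ext¹(𝔟, C) vanishes with Ext²(A/𝔟,
C). -/
lemma IsRegularFractional.subsingleton_ext_one (hdim : ringKrullDim A = 1) {M : Submodule A Q}
    (hM : IsRegularFractional M) {C : Type u} [AddCommGroup C] [Module A C]
    (hC : IsCanonicalModule A C) :
    Subsingleton (Ext (ModuleCat.of A M) (ModuleCat.of A C) 1) := by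
  obtain ⟨a, ha, f, hf, hfa⟩ := hM.exists_linearMap
  obtain ⟨b, hb, hb'⟩ := hM.2
  obtain ⟨h0, h1, h2⟩ := hC.bassNumber_eq hdim
  have hfin : IsFiniteLength A (A ⧸ LinearMap.range f) := by
    refine isFiniteLength_quotient hdim (s := a * b) (mul_mem ha hb) ⟨⟨_, hb'⟩, ?_⟩
    apply IsFractionRing.injective A Q
    exact (hfa _).trans (map_mul _ _ _).symm
  have h := subsingleton_ext_one_ideal (LinearMap.range f) (ModuleCat.of A C)
    (length_ext_one h0 h1 h2 hfin).1.2
  exact (extCongrLeft (LinearEquiv.ofInjective f hf).toModuleIso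
    (ModuleCat.of A C) 1).symm.toEquiv.subsingleton

/-- Canonical duality preserves lengths. -/
lemma length_div_quotient (hdim : ringKrullDim A = 1) {C : Submodule A Q}
    (hC : IsCanonicalModule A C) {N M : Submodule A Q} (hNM : N ≤ M)
    (hN : IsRegularFractional N) (hM : IsRegularFractional M) :
    Module.length A (↥(C / N) ⧸ (C / M).submoduleOf (C / N)) =
      Module.length A (M ⧸ N.submoduleOf M) := by
  obtain ⟨h0, h1, h2⟩ := hC.bassNumber_eq hdim
  have hfl := hN.isFiniteLength hdim hM
  rw [← (length_ext_one h0 h1 h2 hfl).2]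
  have hrange : LinearMap.range (Submodule.inclusion hNM) = N.submoduleOf M :=
    Submodule.range_inclusion _ _ hNM
  obtain ⟨δ, hδ, hδ'⟩ := exists_linearMap_ext_one (Submodule.inclusion hNM) (N.submoduleOf M).mkQ
    (by rw [LinearMap.exact_iff, Submodule.ker_mkQ, hrange])
    (Submodule.inclusion_injective hNM) (Submodule.mkQ_surjective _) C
    (hM.subsingleton_ext_one hdim hC)
  -- Because Ext¹(M, C) = 0, the module Ext¹(M/N, C) is Hom(N, C) modulo restrictions from M.
  -- Multiplication turns this into (C : N)/(C : M).
  let μ : ↥(C / N) →ₗ[A] N →ₗ[A] C :=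
    LinearMap.mk₂ A (fun z y => ⟨z * y, Submodule.mem_div_iff_forall_mul_mem.1 z.2 y y.2⟩)
      (fun _ _ _ => Subtype.ext (by simp [add_mul])) (fun _ _ _ => Subtype.ext (by simp))
      (fun _ _ _ => Subtype.ext (by simp [mul_add])) (fun _ _ _ => Subtype.ext (by simp))
  have hμ (z : ↥(C / N)) (y : N) : (μ z y : Q) = z * y := rfl
  have hμs : Function.Surjective μ := by
    intro φ
    obtain ⟨z, hz⟩ := hN.exists_mul_eq φ
    refine ⟨⟨z, ?_⟩, ?_⟩
    · rw [Submodule.mem_div_iff_forall_mul_mem]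
      intro y hy
      rw [← hz ⟨y, hy⟩]
      exact (φ _).2
    · ext y
      rw [hμ, hz]
  have hker : (C / M).submoduleOf (C / N) = LinearMap.ker (δ ∘ₗ μ) := by
    ext z
    rw [LinearMap.mem_ker, LinearMap.comp_apply, hδ']
    change (z : Q) ∈ C / M ↔ _
    constructor
    · intro hz
      rw [Submodule.mem_div_iff_forall_mul_mem] at hz
      refine ⟨(LinearMap.mulLeft A (z : Q) ∘ₗ M.subtype).codRestrict C fun y => hz y y.2, ?_⟩
      ext y
      rfl
    · rintro ⟨ψ, hψ⟩
      obtain ⟨w, hw⟩ := hM.exists_mul_eq ψ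
      obtain ⟨b, hb, hb'⟩ := hN.2
      have hwz : w = z := by
        have h3 := congrArg Subtype.val (LinearMap.congr_fun hψ ⟨_, hb'⟩)
        rw [hμ, LinearMap.comp_apply, hw] at h3
        exact (isUnit_algebraMap_of_mem hb).mul_right_cancel h3
      rw [Submodule.mem_div_iff_forall_mul_mem, ← hwz]
      intro y hy
      rw [← hw ⟨y, hy⟩]
      exact (ψ _).2
  exact ((Submodule.quotEquivOfEq _ _ hker).trans
    (LinearMap.quotKerEquivOfSurjective _ (hδ.comp hμs))).length_eq

/-- Equal duals mean that the dual quotient, hence M/N itself, has length zero. -/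
lemma eq_of_div_eq_div (hdim : ringKrullDim A = 1) {C : Submodule A Q}
    (hC : IsCanonicalModule A C) {N M : Submodule A Q} (hNM : N ≤ M)
    (hN : IsRegularFractional N) (hM : IsRegularFractional M) (h : C / N ≤ C / M) : N = M := by
  have hl := length_div_quotient hdim hC hNM hN hM
  rw [Submodule.submoduleOf_eq_top.2 h, (Module.length_eq_zero_iff).2 inferInstance] at hl
  have hs := Module.length_eq_zero_iff.1 hl.symm
  rw [Submodule.Quotient.subsingleton_iff, Submodule.submoduleOf_eq_top] at hs
  exact le_antisymm hNM hs

/-- Regular fractional modules are reflexive with respect to the canonical module. -/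
lemma div_div_self (hdim : ringKrullDim A = 1) {C : Submodule A Q}
    (hC : IsCanonicalModule A C) (hCr : IsRegularFractional C) {M : Submodule A Q}
    (hM : IsRegularFractional M) : C / (C / M) = M :=
  -- A module and its double dual have the same dual, since C : M lies in its own double dual.
  (eq_of_div_eq_div hdim hC (le_div_div C M) hM (hCr.div (hCr.div hM)) (le_div_div C (C / M))).symm

end Duality

/-! ### Uniqueness of canonical modules inside the total ring of fractions. -/

section Uniqueness

open scoped nonZeroDivisors

variable {A : Type u} [CommRing A]

/-- The extension of an ideal to the total ring of fractions is isomorphic to it. -/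
def fracIdealEquiv (Q : Type u) [CommRing Q] [Algebra A Q] [IsFractionRing A Q] (N : Ideal A) :
    N ≃ₗ[A] fracIdeal Q N :=
  Submodule.equivMapOfInjective (Algebra.linearMap A Q) (IsFractionRing.injective A Q) N

variable {Q : Type u} [CommRing Q] [Algebra A Q]

lemma mem_fracIdeal {N : Ideal A} {y : Q} :
    y ∈ fracIdeal Q N ↔ ∃ t ∈ N, algebraMap A Q t = y := Iff.rfl

lemma fracIdeal_le_one (N : Ideal A) : fracIdeal Q N ≤ 1 := by
  rintro _ ⟨t, -, rfl⟩
  exact Submodule.algebraMap_mem t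

lemma div_one_eq (C : Submodule A Q) : C / 1 = C := by
  ext y
  rw [Submodule.mem_div_iff_forall_mul_mem]
  refine ⟨fun h => by simpa using h 1 (Submodule.one_le.1 le_rfl), fun h z hz => ?_⟩
  obtain ⟨t, rfl⟩ := Submodule.mem_one.1 hz
  rw [mul_comm, ← Algebra.smul_def]
  exact C.smul_mem _ h

lemma algebraMap_mem_fracIdeal [IsFractionRing A Q] {N : Ideal A} {t : A} :
    algebraMap A Q t ∈ fracIdeal Q N ↔ t ∈ N :=
  ⟨fun ⟨_, hs, h⟩ => IsFractionRing.injective A Q h ▸ hs, fun h => ⟨t, h, rfl⟩⟩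

lemma length_one_quotient_fracIdeal [IsFractionRing A Q] (N : Ideal A) :
    Module.length A (↥(1 : Submodule A Q) ⧸ (fracIdeal Q N).submoduleOf 1) =
      Module.length A (A ⧸ N) := by
  let f : A →ₗ[A] ↥(1 : Submodule A Q) ⧸ (fracIdeal Q N).submoduleOf 1 :=
    ((fracIdeal Q N).submoduleOf 1).mkQ ∘ₗ
      (Algebra.linearMap A Q).codRestrict 1 fun t => Submodule.algebraMap_mem t
  have hf : Function.Surjective f := by
    refine (Submodule.mkQ_surjective _).comp fun y => ?_
    obtain ⟨t, ht⟩ := Submodule.mem_one.1 y.2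
    exact ⟨t, Subtype.ext ht⟩
  have hk : N = LinearMap.ker f := by
    ext t
    rw [LinearMap.mem_ker, LinearMap.comp_apply, Submodule.mkQ_apply,
      Submodule.Quotient.mk_eq_zero, Submodule.submoduleOf, Submodule.mem_comap]
    exact (algebraMap_mem_fracIdeal (Q := Q) (N := N) (t := t)).symm
  have h := (LinearMap.quotKerEquivOfSurjective f hf).length_eq
  rw [← hk] at h
  exact h.symm

lemma IsRegularFractional.of_fg [IsFractionRing A Q] {M : Submodule A Q} (hM : M.FG)
    (h1 : 1 ≤ M) : IsRegularFractional M := by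
  obtain ⟨a, ha, h⟩ := FractionalIdeal.isFractional_of_fg (S := A⁰) hM
  refine ⟨⟨a, ha, fun y hy => ?_⟩, 1, one_mem _, ?_⟩
  · obtain ⟨t, ht⟩ := h y hy
    exact Submodule.mem_one.2 ⟨t, ht⟩
  · rw [map_one]
    exact Submodule.one_le.1 h1

variable [IsNoetherianRing A]

lemma IsRegularFractional.fg [IsFractionRing A Q] {M : Submodule A Q}
    (hM : IsRegularFractional M) : M.FG := by
  obtain ⟨a, ha, f, hf, -⟩ := hM.exists_linearMap
  have : IsNoetherian A M := isNoetherian_of_injective f hf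
  exact (Submodule.fg_top M).1 (IsNoetherian.noetherian _)

variable [IsLocalRing A]

/-- A canonical ideal of a one-dimensional Cohen-Macaulay ring contains a non-zero-divisor. -/
lemma exists_mem_nonZeroDivisors_of_isCanonicalModule (hdim : ringKrullDim A = 1) {s : A}
    (hs : s ∈ A⁰) (hsm : s ∈ maximalIdeal A) {I : Ideal A} (hI : IsCanonicalModule A I) :
    ∃ t ∈ I, t ∈ A⁰ := by
  obtain ⟨h0, h1, h2⟩ := hI.bassNumber_eq hdim
  -- An element r which kills I kills every A/(s^k), so it lies in ⋂ (s^k), which is zero by Krull's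
  -- intersection theorem. Thus I is faithful, and a faithful ideal of a Noetherian ring contains a
  -- regular element.
  have hann (r : A) (hr : ∀ y : I, r • y = 0) : r = 0 := by
    have hne : Ideal.span {s} ≠ ⊤ := fun h =>
      (maximalIdeal.isMaximal A).ne_top
        (top_le_iff.1 (h ▸ (Ideal.span_singleton_le_iff_mem _).2 hsm))
    rw [← Ideal.mem_bot, ← Ideal.iInf_pow_eq_bot_of_isLocalRing _ hne, Ideal.mem_iInf]
    intro k
    have hfl : IsFiniteLength A (A ⧸ Ideal.span {s} ^ k) :=
      isFiniteLength_quotient hdim (pow_mem hs k)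
        (Ideal.pow_mem_pow (Ideal.mem_span_singleton_self s) k)
    have := smul_eq_zero_of_smul_eq_zero h0 h1 h2 hr hfl 1
    rwa [Algebra.smul_def, mul_one, Ideal.Quotient.algebraMap_eq,
      Ideal.Quotient.eq_zero_iff_mem] at this
  have : FaithfulSMul A I := by
    refine ⟨fun {a b} h => ?_⟩
    rw [← sub_eq_zero]
    exact hann _ fun y => by rw [sub_smul, h y, sub_self]
  obtain ⟨t, ht1, ht2⟩ := Ideal.nonempty_inter_nonZeroDivisors_of_faithfulSMul (I := I)
  exact ⟨t, ht1, ht2⟩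

/-- Over a one-dimensional Cohen-Macaulay ring, two regular fractional modules which are canonical
modules differ by a unit of the total ring of fractions. -/
lemma exists_unit_of_isCanonicalModule [IsFractionRing A Q] (hdim : ringKrullDim A = 1) {s : A}
    (hs : s ∈ A⁰) (hsm : s ∈ maximalIdeal A)
    {C D : Submodule A Q} (hC : IsCanonicalModule A C) (hCr : IsRegularFractional C)
    (hD : IsCanonicalModule A D) (hDr : IsRegularFractional D) :
    ∃ z : Qˣ, ∀ y : Q, y ∈ D ↔ y * z ∈ C := by
  -- The module E = C : D is shown to be generated by one element z. A generator is automatically a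
  -- unit of Q, and D = C : E then says that y ∈ D if and only if yz ∈ C.
  let E := C / D
  have hEr : IsRegularFractional E := hCr.div hDr
  have hCE : C / E = D := div_div_self hdim hC hCr hDr
  have hEn : maximalIdeal A • E ≤ E := Submodule.smul_le_right
  have hEm : IsRegularFractional (maximalIdeal A • E) := by
    obtain ⟨b, hb, hb'⟩ := hEr.2
    refine ⟨?_, s * b, mul_mem hs hb, ?_⟩
    · obtain ⟨a, ha, ha'⟩ := hEr.1
      exact ⟨a, ha, fun y hy => ha' y (hEn hy)⟩
    · rw [map_mul, ← Algebra.smul_def]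
      exact Submodule.smul_mem_smul hsm hb'
  have hjac : maximalIdeal A ≤ Ideal.jacobson ⊥ :=
    (IsLocalRing.jacobson_eq_maximalIdeal ⊥ bot_ne_top).ge
  have hE0 : E ≠ ⊥ := by
    obtain ⟨b, hb, hb'⟩ := hEr.2
    intro h0
    rw [h0, Submodule.mem_bot, IsFractionRing.to_map_eq_zero_iff] at hb'
    exact nonZeroDivisors.ne_zero hb hb'
  have hnle : ¬ E ≤ maximalIdeal A • E := fun h => hE0 (le_bot_iff.1
    (Submodule.le_of_le_smul_of_le_jacobson_bot hEr.fg hjac (by rwa [bot_sup_eq])))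
  obtain ⟨z, hzE, hz⟩ := Set.not_subset.1 hnle
  let L : Submodule A Q := Submodule.span A {z} ⊔ maximalIdeal A • E
  have hLE : L ≤ E := sup_le ((Submodule.span_singleton_le_iff_mem _ _).2 hzE) hEn
  have hmL : maximalIdeal A • E ≤ L := le_sup_right
  have hLr : IsRegularFractional L := hEm.mono hmL hEr hLE
  -- Adjunction: C : 𝔪E = (C : E) : 𝔪 = D : 𝔪.
  have hdiv : C / (maximalIdeal A • E) = D / fracIdeal Q (maximalIdeal A) := by
    ext y
    simp only [Submodule.mem_div_iff_forall_mul_mem]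
    constructor
    · rintro h _ ⟨t, ht, rfl⟩
      rw [← hCE, Submodule.mem_div_iff_forall_mul_mem]
      intro e he
      have := h (t • e) (Submodule.smul_mem_smul ht he)
      rwa [Algebra.smul_def, ← mul_assoc] at this
    · intro h w hw
      refine Submodule.smul_induction_on hw (fun t ht e he => ?_) (fun u v hu hv => ?_)
      · have := h _ ⟨t, ht, rfl⟩
        rw [← hCE, Submodule.mem_div_iff_forall_mul_mem] at this
        rw [Algebra.smul_def, ← mul_assoc]
        exact this e he
      · rw [mul_add]
        exact add_mem hu hv
  have hmr : IsRegularFractional (fracIdeal Q (maximalIdeal A)) :=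
    IsRegularFractional.fracIdeal hs hsm
  -- By duality (D : 𝔪)/D has the length of A/𝔪, which is one.
  have hcov : D ⋖ D / fracIdeal Q (maximalIdeal A) := by
    have hle : D ≤ D / fracIdeal Q (maximalIdeal A) := by
      conv_lhs => rw [← div_one_eq D]
      exact div_le_div_left (fracIdeal_le_one _)
    rw [covBy_iff_quot_is_simple hle, ← Module.length_eq_one_iff]
    have h1 := length_div_quotient hdim hD (fracIdeal_le_one _) hmr IsRegularFractional.one
    rw [div_one_eq, length_one_quotient_fracIdeal] at h1
    refine h1.trans ?_
    have : IsSimpleModule A (A ⧸ maximalIdeal A) :=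
      isSimpleModule_iff_isCoatom.2 (maximalIdeal.isMaximal A).out
    exact Module.length_eq_one A _
  -- For L = Az + 𝔪E the dual C : L lies between D and D : 𝔪, so it is one of them, and L is E or
  -- 𝔪E. The second is impossible as z ∉ 𝔪E; Nakayama finishes.
  have hspan : E ≤ Submodule.span A {z} := by
    refine Submodule.le_of_le_smul_of_le_jacobson_bot hEr.fg hjac (le_of_eq ?_)
    have h1 : D ≤ C / L := hCE.ge.trans (div_le_div_left hLE)
    have h2 : C / L ≤ D / fracIdeal Q (maximalIdeal A) := (div_le_div_left hmL).trans hdiv.le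
    rcases hcov.eq_or_eq h1 h2 with h | h
    · exact (eq_of_div_eq_div hdim hC hLE hLr hEr (by rw [h, hCE])).symm
    · exfalso
      have := eq_of_div_eq_div hdim hC hmL hEm hLr (by rw [h, hdiv])
      apply hz
      rw [this]
      exact Submodule.mem_sup_left (Submodule.mem_span_singleton_self z)
  have hzu : IsUnit z := by
    obtain ⟨b, hb, hb'⟩ := hEr.2
    obtain ⟨t, ht⟩ := Submodule.mem_span_singleton.1 (hspan hb')
    have hbu := isUnit_algebraMap_of_mem (Q := Q) hb
    rw [← ht, Algebra.smul_def] at hbu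
    exact isUnit_of_mul_isUnit_right hbu
  obtain ⟨u, rfl⟩ := hzu
  refine ⟨u, fun y => ?_⟩
  rw [← hCE, Submodule.mem_div_iff_forall_mul_mem]
  refine ⟨fun h => h u hzE, fun h e he => ?_⟩
  obtain ⟨t, rfl⟩ := Submodule.mem_span_singleton.1 (hspan he)
  rw [mul_smul_comm]
  exact C.smul_mem _ h

end Uniqueness

/-! ### Subquotients induced from the base ring, and their lengths after localization. -/

section SubquotientLemmas

variable {S M : Type u} [CommRing S] [AddCommGroup M] [Module S M]

lemma Subquotient.mk_surjective (P N : Submodule S M) : Function.Surjective (Subquotient.mk P N) :=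
  Submodule.mkQ_surjective _

lemma Subquotient.mk_eq_zero_iff {P N : Submodule S M} {y : P} :
    Subquotient.mk P N y = 0 ↔ (y : M) ∈ N :=
  Submodule.Quotient.mk_eq_zero _

variable {A : Type u} [CommRing A] [Algebra A S]

instance (P N : Submodule S M) : Module A (Subquotient P N) :=
  Module.compHom _ (algebraMap A S)

instance (P N : Submodule S M) : IsScalarTower A S (Subquotient P N) :=
  IsScalarTower.of_algebraMap_smul fun _ _ => rfl

open scoped TensorProduct

/-- A criterion for a quotient of submodules to be induced from the base ring. -/
lemma Subquotient.nonempty_tensor_equiv [Module A M] [IsScalarTower A S M]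
    {P N : Submodule S M} {E : Type u} [AddCommGroup E] [Module A E] (E' : Submodule A E) (τ : E →ₗ[A] P) (hτ : ∀ c ∈ E', (τ c : M) ∈ N)
    (hgen : Submodule.span S {s | ∃ c, s = Subquotient.mk P N (τ c)} = ⊤)
    {ι : Type*} (b : Module.Basis ι A S)
    (hb : ∀ (s : Finset ι) (c : ι → E), (∑ i ∈ s, b i • (τ (c i) : M)) ∈ N →
      ∀ i ∈ s, c i ∈ E') :
    Nonempty (S ⊗[A] (E ⧸ E') ≃ₗ[S] Subquotient P N) := by
  let σ : E →ₗ[A] Subquotient P N := (Subquotient.mk P N).restrictScalars A ∘ₗ τ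
  let σ' := E'.liftQ σ fun c hc => Subquotient.mk_eq_zero_iff.2 (hτ c hc)
  let θ : S ⊗[A] (E ⧸ E') →ₗ[S] Subquotient P N := LinearMap.liftBaseChange S σ'
  have hsurj : Function.Surjective θ := by
    rw [← LinearMap.range_eq_top, eq_top_iff, ← hgen, Submodule.span_le]
    rintro _ ⟨c, rfl⟩
    exact ⟨1 ⊗ₜ Submodule.Quotient.mk c, LinearMap.liftBaseChange_one_tmul _ _ _⟩
  have hinj : Function.Injective θ := by
    rw [← LinearMap.ker_eq_bot, LinearMap.ker_eq_bot']
    intro z hz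
    classical
    -- Along the basis b, a tensor is a finite family of classes in E/E'; the hypothesis `hb` makes
    -- each class vanish when the image does.
    obtain ⟨w, rfl⟩ := (TensorProduct.equivFinsuppOfBasisLeft b).symm.surjective z
    rw [LinearEquiv.map_eq_zero_iff]
    choose c hc using fun i => E'.mkQ_surjective (w i)
    have hsum : ((∑ i ∈ w.support, b i • τ (c i) : P) : M) ∈ N := by
      rw [← Subquotient.mk_eq_zero_iff, map_sum, ← hz,
        TensorProduct.equivFinsuppOfBasisLeft_symm_apply, Finsupp.sum, map_sum]
      refine Finset.sum_congr rfl fun i _ => ?_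
      rw [LinearMap.liftBaseChange_tmul, ← hc i, map_smul]
      rfl
    rw [AddSubmonoidClass.coe_finsetSum] at hsum
    by_contra hw
    obtain ⟨k, hk⟩ := Finsupp.support_nonempty_iff.2 hw
    refine Finsupp.mem_support_iff.1 hk ?_
    rw [← hc k, Submodule.mkQ_apply, Submodule.Quotient.mk_eq_zero]
    exact hb w.support c hsum k hk
  exact ⟨LinearEquiv.ofBijective θ ⟨hinj, hsurj⟩⟩

/-- If `S` is free over the local ring `A` and `𝔪S` is prime, then the localization at `𝔪S` of
a module which is induced from an `A`-module has the same length. -/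
lemma length_localizedModule_of_equiv [IsLocalRing A] [Module.Free A S] (p : Ideal S) [p.IsPrime]
    (hp : p = (maximalIdeal A).map (algebraMap A S)) {W L : Type u} [AddCommGroup W] [Module A W]
    [AddCommGroup L] [Module S L] (e : S ⊗[A] W ≃ₗ[S] L) :
    Module.length (Localization.AtPrime p) (LocalizedModule p.primeCompl L) =
      Module.length A W := by
  have hmax : (maximalIdeal A).map (algebraMap A (Localization.AtPrime p)) =
      maximalIdeal (Localization.AtPrime p) := by
    rw [IsScalarTower.algebraMap_eq A S, ← Ideal.map_map, ← hp]
    exact Localization.AtPrime.map_eq_maximalIdeal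
  have hloc : IsLocalHom (algebraMap A (Localization.AtPrime p)) :=
    ((IsLocalRing.local_hom_TFAE (algebraMap A (Localization.AtPrime p))).out 0 2).2 hmax.le
  have hflat : Module.Flat A (Localization.AtPrime p) :=
    Module.Flat.trans A S (Localization.AtPrime p)
  -- Flat local base change multiplies length by that of the closed fibre, which is a field here by
  -- `hmax`.
  have hlen := IsLocalRing.length_baseChange A (Localization.AtPrime p) W
  have hsimple : IsSimpleModule (Localization.AtPrime p)
      (Localization.AtPrime p ⧸ maximalIdeal (Localization.AtPrime p)) :=
    isSimpleModule_iff_isCoatom.2 (maximalIdeal.isMaximal (Localization.AtPrime p)).out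
  rw [hmax, Module.length_eq_one (Localization.AtPrime p)
    (Localization.AtPrime p ⧸ maximalIdeal (Localization.AtPrime p)), mul_one] at hlen
  rw [← hlen]
  exact ((LocalizedModule.equivTensorProduct p.primeCompl L).trans
    ((TensorProduct.AlgebraTensorModule.congr (LinearEquiv.refl _ _) e.symm).trans
      (TensorProduct.AlgebraTensorModule.cancelBaseChange A S (Localization.AtPrime p)
        (Localization.AtPrime p) W))).length_eq

end SubquotientLemmas

/-! ### The Sally module of J with respect to a principal ideal (x) when J³ = xJ². -/

section SallyModuleRank

open scoped nonZeroDivisors TensorProduct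

variable {A : Type u} [CommRing A]

/-- The module is graded with i-th component J Lⁱ; stability under the Rees algebra of Q uses Q ⊆ L.
-/
lemma mem_extRees_iff {Q J L : Ideal A} (hQL : Q ≤ L) {f : A[X]} :
    f ∈ extRees Q J L ↔ ∀ i, f.coeff i ∈ J * L ^ i := by
  constructor
  · intro hf
    refine Submodule.span_induction ?_ ?_ ?_ ?_ hf
    · rintro _ ⟨y, hy, g, hg, rfl⟩ i
      rw [coeff_C_mul]
      exact Ideal.mul_mem_mul hy (hg i)
    · intro i
      rw [coeff_zero]
      exact zero_mem _
    · intro g h _ _ hg hh i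
      rw [coeff_add]
      exact add_mem (hg i) (hh i)
    · rintro ⟨g, hg⟩ h - hh i
      change (g * h).coeff i ∈ _
      rw [coeff_mul]
      refine Ideal.sum_mem _ ?_
      rintro ⟨j, k⟩ e
      rw [← Finset.HasAntidiagonal.mem_antidiagonal.mp e, pow_add, mul_left_comm]
      exact Ideal.mul_mem_mul (Ideal.pow_right_mono hQL j (hg j)) (hh k)
  · intro hf
    rw [f.as_sum_support]
    refine Submodule.sum_mem _ fun i _ => ?_
    refine Submodule.mul_induction_on (hf i) (fun y hy z hz => ?_) (fun y z hy hz => ?_)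
    · rw [← C_mul_monomial]
      exact Submodule.subset_span ⟨y, hy, _, reesAlgebra.monomial_mem.2 hz, rfl⟩
    · rw [map_add]
      exact add_mem hy hz

lemma mem_mul_span_singleton_pow {x c : A} {J : Ideal A} {k : ℕ} :
    c ∈ J * Ideal.span {x} ^ k ↔ ∃ y ∈ J, x ^ k * y = c := by
  rw [Ideal.span_singleton_pow, mul_comm, Ideal.mem_span_singleton_mul]

lemma pow_eq_of_pow_three_eq {x : A} {J : Ideal A} (hJ : J ^ 3 = Ideal.span {x} * J ^ 2) (k : ℕ) :
    J ^ (k + 2) = J ^ 2 * Ideal.span {x} ^ k := by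
  induction k with
  | zero => simp
  | succ k ih =>
    calc J ^ (k + 1 + 2) = J ^ (k + 2) * J := by rw [← pow_succ]
      _ = J ^ 3 * Ideal.span {x} ^ k := by rw [ih]; ring
      _ = J ^ 2 * Ideal.span {x} ^ (k + 1) := by rw [hJ]; ring

variable {x : A}

/-- If `x` is a non-zero-divisor, then the Rees algebra of `(x)` is a polynomial ring. -/
lemma exists_reesAlgebra_equiv (hx : x ∈ A⁰) : ∃ ψ : A[X] ≃ₐ[A] reesAlgebra (Ideal.span {x}),
    ∀ i, (ψ (monomial i 1) : A[X]) = monomial i (x ^ i) := by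
  -- The variable goes to xt, which multiplies the i-th coefficient by xⁱ; regularity of x gives
  -- injectivity.
  let φ : A[X] →ₐ[A] A[X] := aeval (C x * X)
  have hφ (f : A[X]) (i : ℕ) : (φ f).coeff i = f.coeff i * x ^ i := by
    rw [← comp_C_mul_X_coeff]
    rfl
  let ψ : A[X] →ₐ[A] reesAlgebra (Ideal.span {x}) := φ.codRestrict _ fun f i => by
    rw [hφ]
    exact Ideal.mul_mem_left _ _ (Ideal.pow_mem_pow (Ideal.mem_span_singleton_self x) i)
  have hψ (f : A[X]) : (ψ f : A[X]) = φ f := rfl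
  have hbij : Function.Bijective ψ := by
    constructor
    · intro f g hfg
      ext i
      have := congrArg (fun h : reesAlgebra (Ideal.span {x}) => (h : A[X]).coeff i) hfg
      simp only [hψ, hφ] at this
      exact (mem_nonZeroDivisors_iff_right.1 (pow_mem hx i) |> fun h =>
        sub_eq_zero.1 (h _ (by rw [sub_mul, this, sub_self])))
    · rintro ⟨g, hg⟩
      have hg' (i : ℕ) : ∃ h, h * x ^ i = g.coeff i := by
        have := hg i
        rwa [Ideal.span_singleton_pow, Ideal.mem_span_singleton'] at this
      choose h hh using hg'
      refine ⟨∑ i ∈ g.support, monomial i (h i), Subtype.ext ?_⟩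
      ext j
      rw [hψ, hφ, finsetSum_coeff]
      simp only [coeff_monomial, Finset.sum_ite_eq', mem_support_iff]
      split_ifs with hj
      · exact hh j
      · rw [notMem_support_iff.1 hj, zero_mul]
  refine ⟨AlgEquiv.ofBijective ψ hbij, fun i => ?_⟩
  ext j
  rw [AlgEquiv.ofBijective_apply, hψ, hφ, coeff_monomial, coeff_monomial]
  split_ifs with h
  · rw [h, one_mul]
  · rw [zero_mul]

variable {J : Ideal A} (hxJ : x ∈ J)
include hxJ

lemma sum_monomial_extRees (f : extRees (Ideal.span {x}) J J) :
    ∃ g : ℕ → extRees (Ideal.span {x}) J J, (∀ i, (g i : A[X]) = monomial i ((f : A[X]).coeff i)) ∧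
      f = ∑ i ∈ (f : A[X]).support, g i := by
  have hle : Ideal.span {x} ≤ J := (Ideal.span_singleton_le_iff_mem J).2 hxJ
  have hf := (mem_extRees_iff hle).1 f.2
  refine ⟨fun i => ⟨monomial i ((f : A[X]).coeff i), (mem_extRees_iff hle).2 fun j => ?_⟩,
    fun i => rfl, Subtype.ext ?_⟩
  · rw [coeff_monomial]
    split_ifs with h
    · exact h ▸ hf i
    · exact zero_mem _
  · rw [AddSubmonoidClass.coe_finsetSum]
    exact (f : A[X]).as_sum_support

/-- In degree k + 1 the component of J𝓡(J) is J^{k+2} = x^k J², so its elements are (xt)^k times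
some yt with y ∈ J². Degree 0 dies in the quotient, both components being J. -/
lemma sallyGeneratedInDegreeOne_of_pow_eq (hJ : J ^ 3 = Ideal.span {x} * J ^ 2) :
    SallyGeneratedInDegreeOne (Ideal.span {x}) J := by
  have hle : Ideal.span {x} ≤ J := (Ideal.span_singleton_le_iff_mem J).2 hxJ
  rw [SallyGeneratedInDegreeOne, eq_top_iff]
  rintro s -
  obtain ⟨f, rfl⟩ := Subquotient.mk_surjective _ _ s
  obtain ⟨g, hg, hfg⟩ := sum_monomial_extRees hxJ f
  rw [hfg, map_sum]
  refine Submodule.sum_mem _ fun i _ => ?_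
  have hi := (mem_extRees_iff hle).1 f.2 i
  rcases i with _ | k
  · have : Subquotient.mk (extRees (Ideal.span {x}) J J)
        (extRees (Ideal.span {x}) J (Ideal.span {x})) (g 0) = 0 := by
      rw [Subquotient.mk_eq_zero_iff, hg, mem_extRees_iff le_rfl]
      intro j
      rw [coeff_monomial]
      split_ifs with h
      · subst h
        simpa using hi
      · exact zero_mem _
    rw [this]
    exact zero_mem _
  · rw [← pow_succ', show k + 1 + 1 = k + 2 from rfl, pow_eq_of_pow_three_eq hJ,
      mem_mul_span_singleton_pow] at hi
    obtain ⟨y, hy, hyk⟩ := hi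
    have hmem : (monomial 1 y : A[X]) ∈ extRees (Ideal.span {x}) J J := by
      rw [mem_extRees_iff hle]
      intro j
      rw [coeff_monomial]
      split_ifs with h
      · subst h
        rwa [pow_one, ← pow_two]
      · exact zero_mem _
    have hb : (monomial k (x ^ k) : A[X]) ∈ reesAlgebra (Ideal.span {x}) :=
      reesAlgebra.monomial_mem.2 (Ideal.pow_mem_pow (Ideal.mem_span_singleton_self x) k)
    have : g (k + 1) = (⟨_, hb⟩ : reesAlgebra (Ideal.span {x})) •
        (⟨_, hmem⟩ : extRees (Ideal.span {x}) J J) := by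
      apply Subtype.ext
      rw [hg, ← hyk]
      change _ = (monomial k (x ^ k) : A[X]) * monomial 1 y
      rw [monomial_mul_monomial]
    rw [this, map_smul]
    exact Submodule.smul_mem _ _ (Submodule.subset_span ⟨_, ⟨y, rfl⟩, rfl⟩)

/-- The Sally module `J𝓡(J)/J𝓡(Q)` for `Q = (x)` is induced from the `A`-module `J²/xJ`. -/
lemma exists_sallyModule_equiv (hx : x ∈ A⁰) (hJ : J ^ 3 = Ideal.span {x} * J ^ 2) :
    Nonempty (reesAlgebra (Ideal.span {x}) ⊗[A]
        (↥(J ^ 2) ⧸ (Ideal.span {x} * J).submoduleOf (J ^ 2)) ≃ₗ[reesAlgebra (Ideal.span {x})]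
      SallyModule (Ideal.span {x}) J) := by
  have hle : Ideal.span {x} ≤ J := (Ideal.span_singleton_le_iff_mem J).2 hxJ
  have hgen := sallyGeneratedInDegreeOne_of_pow_eq hxJ hJ
  obtain ⟨ψ, hψ⟩ := exists_reesAlgebra_equiv hx
  have hmem (c : ↥(J ^ 2)) : (monomial 1 (c : A) : A[X]) ∈ extRees (Ideal.span {x}) J J := by
    rw [mem_extRees_iff hle]
    intro j
    rw [coeff_monomial]
    split_ifs with h
    · subst h
      rw [pow_one, ← pow_two]
      exact c.2
    · exact zero_mem _
  let τ : ↥(J ^ 2) →ₗ[A] extRees (Ideal.span {x}) J J :=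
    { toFun := fun c => ⟨monomial 1 (c : A), hmem c⟩
      map_add' := fun c d => Subtype.ext (map_add _ _ _)
      map_smul' := fun r c => Subtype.ext (map_smul (monomial 1) r (c : A)) }
  -- The basis consists of the powers (xt)ⁱ.
  let b : Module.Basis ℕ A (reesAlgebra (Ideal.span {x})) :=
    (Polynomial.basisMonomials A).map ψ.toLinearEquiv
  have hb (i : ℕ) : (b i : A[X]) = monomial i (x ^ i) := by
    rw [← hψ i]
    simp [b]
  refine Subquotient.nonempty_tensor_equiv _ τ (fun c hc => ?_) ?_ b (fun s c hs k hk => ?_)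
  · change (monomial 1 (c : A) : A[X]) ∈ _
    rw [mem_extRees_iff le_rfl]
    intro j
    rw [coeff_monomial]
    split_ifs with h
    · subst h
      rw [pow_one, mul_comm]
      exact hc
    · exact zero_mem _
  · rw [eq_top_iff]
    refine hgen.ge.trans (Submodule.span_mono ?_)
    rintro _ ⟨f, ⟨y, hy⟩, rfl⟩
    have hyJ : y ∈ J ^ 2 := by
      have := (mem_extRees_iff hle).1 f.2 1
      rwa [hy, coeff_monomial_same, pow_one, ← pow_two] at this
    exact ⟨⟨y, hyJ⟩, congrArg _ (Subtype.ext hy)⟩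
  -- The summands have distinct degrees i + 1. Membership in J𝓡(Q) puts x^k c_k in x^{k+1} J, and
  -- cancelling x^k gives c_k ∈ xJ.
  · have hcoe : (∑ i ∈ s, b i • (τ (c i) : A[X])) =
        ∑ i ∈ s, monomial (i + 1) (x ^ i * (c i : A)) := by
      refine Finset.sum_congr rfl fun i _ => ?_
      change (b i : A[X]) * monomial 1 (c i : A) = _
      rw [hb, monomial_mul_monomial]
    rw [hcoe, mem_extRees_iff le_rfl] at hs
    have h2 := hs (k + 1)
    rw [finsetSum_coeff] at h2
    simp only [coeff_monomial, add_left_inj, Finset.sum_ite_eq', if_pos hk] at h2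
    rw [mem_mul_span_singleton_pow] at h2
    obtain ⟨y, hy, hyk⟩ := h2
    have h3 : (c k : A) = x * y := by
      have h4 : ((c k : A) - x * y) * x ^ k = 0 := by linear_combination - hyk
      exact sub_eq_zero.1 (mem_nonZeroDivisors_iff_right.1 (pow_mem hx k) _ h4)
    change (c k : A) ∈ Ideal.span {x} * J
    rw [h3]
    exact Ideal.mul_mem_mul (Ideal.mem_span_singleton_self x) hy

/-- If `J³ = xJ²` for a non-zero-divisor `x ∈ J`, then the Sally module of `J` with respect to `(x)`
has rank `ℓ(J²/xJ)`. -/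
lemma sallyRankEq_of_pow_eq [IsLocalRing A] (hx : x ∈ A⁰) (hJ : J ^ 3 = Ideal.span {x} * J ^ 2)
    {n : ℕ} (hn : Module.length A (↥(J ^ 2) ⧸ (Ideal.span {x} * J).submoduleOf (J ^ 2)) = n) :
    SallyRankEq (Ideal.span {x}) J n := by
  obtain ⟨e⟩ := exists_sallyModule_equiv hxJ hx hJ
  obtain ⟨ψ, -⟩ := exists_reesAlgebra_equiv hx
  have hp : ((maximalIdeal A).map (algebraMap A (reesAlgebra (Ideal.span {x})))).IsPrime := by
    have h1 : ((maximalIdeal A).map (C : A →+* A[X])).IsPrime := inferInstance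
    have h2 : (maximalIdeal A).map (algebraMap A (reesAlgebra (Ideal.span {x}))) =
        ((maximalIdeal A).map (C : A →+* A[X])).map
          (ψ : A[X] →+* reesAlgebra (Ideal.span {x})) := by
      rw [Ideal.map_map]
      congr 1
      exact (ψ.toAlgHom.comp_algebraMap).symm
    rw [h2]
    exact Ideal.map_isPrime_of_equiv ψ
  have hfree : Module.Free A (reesAlgebra (Ideal.span {x})) := Module.Free.of_equiv ψ.toLinearEquiv
  exact ⟨_, hp, rfl, (length_localizedModule_of_equiv _ rfl e).trans hn⟩

end SallyModuleRank

/-! ### Local rings with a principal nilpotent maximal ideal. -/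

section ChainRings

variable {E : Type u} [CommRing E] [IsLocalRing E]

/-- Equality would give ξ^m(1 - tξ) = 0 with 1 - tξ a unit. An ideal strictly between contains some
uξ^m outside the smaller one; u is then not divisible by ξ, hence a unit. -/
lemma covBy_span_pow_succ {ξ : E} (hξ : maximalIdeal E = Ideal.span {ξ}) {m : ℕ}
    (hm : ξ ^ m ≠ 0) : Ideal.span {ξ ^ (m + 1)} ⋖ Ideal.span {ξ ^ m} := by
  have hξm : ξ ∈ maximalIdeal E := hξ ▸ Ideal.mem_span_singleton_self ξ
  refine ⟨lt_of_le_of_ne ?_ fun h => ?_, fun N hN1 hN2 => ?_⟩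
  · rw [Ideal.span_singleton_le_span_singleton]
    exact pow_dvd_pow _ (Nat.le_succ m)
  · have h1 : ξ ^ m ∈ Ideal.span {ξ ^ (m + 1)} := h ▸ Ideal.mem_span_singleton_self _
    obtain ⟨t, ht⟩ := Ideal.mem_span_singleton'.1 h1
    have hu : IsUnit (1 - t * ξ) := by
      by_contra hu
      have h2 := add_mem ((mem_maximalIdeal _).2 hu) (Ideal.mul_mem_left _ t hξm)
      rw [sub_add_cancel] at h2
      exact (Ideal.ne_top_iff_one _).1 (maximalIdeal.isMaximal E).ne_top h2
    have h3 : ξ ^ m * (1 - t * ξ) = 0 := by linear_combination - ht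
    exact hm (hu.mul_left_eq_zero.1 h3)
  · obtain ⟨y, hy, hy'⟩ := Set.exists_of_ssubset hN1
    obtain ⟨u, rfl⟩ := Ideal.mem_span_singleton'.1 (hN2.le hy)
    by_cases hu : IsUnit u
    · refine hN2.not_ge ((Ideal.span_singleton_le_iff_mem _).2 ?_)
      exact (Ideal.unit_mul_mem_iff_mem _ hu).1 hy
    · obtain ⟨t, rfl⟩ := Ideal.mem_span_singleton'.1 (hξ ▸ (mem_maximalIdeal _).2 hu)
      exact hy' (Ideal.mem_span_singleton'.2 ⟨t, by ring⟩)

/-- A local ring whose maximal ideal is generated by an element `ξ` with `ξ^n = 0` and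
`ξ^m ≠ 0` for `m < n` has length `n`. -/
lemma length_eq_of_maximalIdeal_eq_span {ξ : E} (hξ : maximalIdeal E = Ideal.span {ξ}) {n : ℕ}
    (h0 : ξ ^ n = 0) (hn : ∀ m < n, ξ ^ m ≠ 0) : Module.length E E = n := by
  let s : CompositionSeries (Submodule E E) :=
    { length := n
      -- The exponent decreases so that the chain ascends from (ξⁿ) = 0 to (ξ⁰) = E.
      toFun := fun i => Ideal.span {ξ ^ (n - (i : ℕ))}
      step := fun i => by
        have h1 : n - (i.castSucc : ℕ) = (n - (i.succ : ℕ)) + 1 := by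
          have := i.2
          simp only [Fin.val_castSucc, Fin.val_succ]
          omega
        change Ideal.span {ξ ^ (n - (i.castSucc : ℕ))} ⋖ Ideal.span {ξ ^ (n - (i.succ : ℕ))}
        rw [h1]
        refine covBy_span_pow_succ hξ (hn _ ?_)
        have := i.2
        simp only [Fin.val_succ]
        omega }
  rw [← Module.length_compositionSeries s]
  · change Ideal.span {ξ ^ (n - 0)} = ⊥
    rw [Nat.sub_zero, h0, Ideal.span_singleton_eq_bot]
  · change Ideal.span {ξ ^ (n - n)} = ⊤
    rw [Nat.sub_self, pow_zero, Ideal.span_singleton_one]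

end ChainRings

/-! ### The ideals J_k generated by X_1^k, X_2, …, X_d. -/

section ParameterPowers

variable {T : Type u} [CommRing T]

lemma powFirst_mem_idealJ {d : ℕ} (X : Fin d → T) (k : ℕ) (j : Fin d) :
    powFirst X k j ∈ idealJ X k := Ideal.subset_span ⟨j, rfl⟩

lemma mem_idealJ_of_ne_zero {d : ℕ} {X : Fin d → T} {k : ℕ} {j : Fin d} (hj : (j : ℕ) ≠ 0) :
    X j ∈ idealJ X k := by
  have := powFirst_mem_idealJ X k j
  rwa [powFirst, if_neg hj] at this

lemma pow_mem_idealJ {d : ℕ} {X : Fin d → T} {k : ℕ} {j : Fin d} (hj : (j : ℕ) = 0) :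
    X j ^ k ∈ idealJ X k := by
  have := powFirst_mem_idealJ X k j
  rwa [powFirst, if_pos hj] at this

lemma pow_mul_mem_idealJ {d : ℕ} {X : Fin d → T} {j : Fin d} (hj : (j : ℕ) = 0) {k n : ℕ}
    (hkn : k ≤ n) {t : T} (ht : t ∈ idealJ X k) : X j ^ (n - k) * t ∈ idealJ X n := by
  suffices h : idealJ X k ≤ Submodule.comap (LinearMap.mulLeft T (X j ^ (n - k))) (idealJ X n) from
    h ht
  refine Submodule.span_le.2 ?_
  rintro _ ⟨i, rfl⟩
  change X j ^ (n - k) * powFirst X k i ∈ idealJ X n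
  by_cases hi : (i : ℕ) = 0
  · obtain rfl : i = j := Fin.ext (hi.trans hj.symm)
    rw [powFirst, if_pos hi, ← pow_add, Nat.sub_add_cancel hkn]
    exact pow_mem_idealJ hi
  · rw [powFirst, if_neg hi]
    exact Ideal.mul_mem_left _ _ (mem_idealJ_of_ne_zero hi)

/-- In a Noetherian local ring, the power `X_1^m` of the first member of a system of
parameters does not lie in `(X_1^n, X_2, …, X_d)` if `m < n`. -/
lemma pow_notMem_idealJ [IsLocalRing T] [IsNoetherianRing T] {d : ℕ}
    (hdim : ringKrullDim T = d) {X : Fin d → T}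
    (hX : Ideal.span (Set.range X) = maximalIdeal T) {j : Fin d} (hj : (j : ℕ) = 0) {m n : ℕ}
    (hmn : m < n) : X j ^ m ∉ idealJ X n := by
  intro h
  have hXm : X j ∈ maximalIdeal T := hX ▸ Ideal.subset_span ⟨j, rfl⟩
  let N : Ideal T := Ideal.span (X '' {i | (i : ℕ) ≠ 0})
  have hle : idealJ X n ≤ Ideal.span {X j ^ n} ⊔ N := by
    refine Ideal.span_le.2 ?_
    rintro _ ⟨i, rfl⟩
    by_cases hi : (i : ℕ) = 0
    · obtain rfl : i = j := Fin.ext (hi.trans hj.symm)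
      rw [powFirst, if_pos hi]
      exact Ideal.mem_sup_left (Ideal.mem_span_singleton_self _)
    · rw [powFirst, if_neg hi]
      exact Ideal.mem_sup_right (Ideal.subset_span ⟨i, hi, rfl⟩)
  obtain ⟨y, hy, w, hw, hyw⟩ := Submodule.mem_sup.1 (hle h)
  obtain ⟨t, rfl⟩ := Ideal.mem_span_singleton'.1 hy
  have hu : IsUnit (1 - t * X j ^ (n - m)) := by
    by_contra hu
    have h2 := add_mem ((mem_maximalIdeal _).2 hu) (Ideal.mul_mem_left _ t
      (Ideal.pow_mem_of_mem _ hXm (n - m) (by omega)))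
    rw [sub_add_cancel] at h2
    exact (Ideal.ne_top_iff_one _).1 (maximalIdeal.isMaximal T).ne_top h2
  -- In X_1^m = tX_1^n + w with w ∈ N = (X_2, …, X_d), the unit 1 - tX_1^{n-m} can be factored out.
  -- So every prime over N contains X_1, hence 𝔫, and N has height d with fewer than d generators,
  -- against Krull's height theorem.
  have hmem : X j ^ m ∈ N := by
    rw [← Ideal.unit_mul_mem_iff_mem _ hu]
    have h3 : X j ^ n = X j ^ (n - m) * X j ^ m := by
      rw [← pow_add, Nat.sub_add_cancel hmn.le]
    have h4 : (1 - t * X j ^ (n - m)) * X j ^ m = w := by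
      rw [h3] at hyw
      linear_combination - hyw
    rwa [h4]
  have hN : N ≠ ⊤ := by
    refine fun hN => (maximalIdeal.isMaximal T).ne_top (top_le_iff.1 (hN ▸ ?_))
    rw [← hX]
    exact Ideal.span_mono (Set.image_subset_range _ _)
  have hheight : (maximalIdeal T).height ≤ N.height := by
    rw [N.height_eq_inf_minimalPrimes]
    refine le_iInf₂ fun p hp => ?_
    have hpp : p.IsPrime := hp.1.1
    refine Ideal.height_mono ?_
    rw [← hX, Ideal.span_le]
    rintro _ ⟨i, rfl⟩
    by_cases hi : (i : ℕ) = 0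
    · obtain rfl : i = j := Fin.ext (hi.trans hj.symm)
      exact hpp.mem_of_pow_mem m (hp.1.2 hmem)
    · exact hp.1.2 (Ideal.subset_span ⟨i, hi, rfl⟩)
  have hcard : (X '' {i | (i : ℕ) ≠ 0}).ncard < d := by
    refine (Set.ncard_image_le (Set.toFinite _)).trans_lt ?_
    have h5 := Set.ncard_lt_card (s := {i : Fin d | (i : ℕ) ≠ 0})
      (fun h6 => (h6 ▸ Set.mem_univ j : j ∈ {i : Fin d | (i : ℕ) ≠ 0}) hj)
    rwa [Nat.card_fin] at h5
  have hspan : N.spanFinrank < d :=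
    (Submodule.spanFinrank_span_le_ncard_of_finite (Set.toFinite _)).trans_lt hcard
  have h7 : ((maximalIdeal T).height : WithBot ℕ∞) = d :=
    IsLocalRing.maximalIdeal_height_eq_ringKrullDim.trans hdim
  have h8 : (maximalIdeal T).height = d := by exact_mod_cast h7
  have h9 := hheight.trans (N.height_le_spanFinrank hN)
  rw [h8] at h9
  exact absurd hspan (not_lt.2 (by exact_mod_cast h9))

lemma maximalIdeal_eq_sup_span [IsLocalRing T] {d : ℕ} {X : Fin d → T}
    (hX : Ideal.span (Set.range X) = maximalIdeal T) {j : Fin d} (hj : (j : ℕ) = 0) {n : ℕ}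
    (hn : n ≠ 0) : maximalIdeal T = idealJ X n ⊔ Ideal.span {X j} := by
  rw [← hX]
  apply le_antisymm
  · refine Ideal.span_le.2 ?_
    rintro _ ⟨i, rfl⟩
    by_cases hi : (i : ℕ) = 0
    · obtain rfl : i = j := Fin.ext (hi.trans hj.symm)
      exact Ideal.mem_sup_right (Ideal.mem_span_singleton_self _)
    · exact Ideal.mem_sup_left (mem_idealJ_of_ne_zero hi)
  · refine sup_le (Ideal.span_le.2 ?_)
      ((Ideal.span_singleton_le_iff_mem _).2 (Ideal.subset_span (Set.mem_range_self j)))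
    rintro _ ⟨i, rfl⟩
    rw [powFirst]
    split_ifs with hi
    · exact Ideal.pow_mem_of_mem _ (Ideal.subset_span (Set.mem_range_self i)) n
        (Nat.pos_of_ne_zero hn)
    · exact Ideal.subset_span ⟨i, rfl⟩

end ParameterPowers

/-! ### From R : K to the conductor. -/

section Conductor

variable {A : Type u} [CommRing A]

/-- If `A : K` is an `A[K]`-module, then it is the conductor `A : A[K]`. -/
lemma conductorOf_eq {K : Submodule A (FractionRing A)} {N : Ideal A}
    (h1 : 1 / K = fracIdeal (FractionRing A) N)
    (h2 : ∀ y ∈ fracIdeal (FractionRing A) N, ∀ z ∈ K, y * z ∈ fracIdeal (FractionRing A) N) :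
    conductorOf K = N := by
  ext t
  rw [← algebraMap_mem_fracIdeal (Q := FractionRing A) (N := N), ← h1]
  change algebraMap A (FractionRing A) t ∈ (1 : Submodule A (FractionRing A)) /
    Subalgebra.toSubmodule (Algebra.adjoin A (K : Set (FractionRing A))) ↔ _
  constructor
  · exact fun h => div_le_div_left (fun z hz => Algebra.subset_adjoin hz) h
  · intro h
    rw [Submodule.mem_div_iff_forall_mul_mem]
    intro z hz
    refine fracIdeal_le_one N ?_
    -- The multipliers of N into itself form an A-algebra; it contains K, hence A[K].
    have h3 : ∀ y ∈ fracIdeal (FractionRing A) N, y * z ∈ fracIdeal (FractionRing A) N := by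
      refine Algebra.adjoin_induction (fun z hz y hy => h2 y hy z hz) (fun r y hy => ?_)
        (fun z w _ _ hz hw y hy => ?_) (fun z w _ _ hz hw y hy => ?_) hz
      · rw [mul_comm, ← Algebra.smul_def]
        exact Submodule.smul_mem _ r hy
      · rw [mul_add]
        exact add_mem (hz y hy) (hw y hy)
      · rw [← mul_assoc]
        exact hw _ (hz y hy)
    exact h3 _ (h1 ▸ h)

end Conductor

/-! ### Reading R : K off the block presentation. -/

section BlockPresentation

variable {T : Type u} [CommRing T] {𝔞 : Ideal T}
  {K : Submodule (T ⧸ 𝔞) (FractionRing (T ⧸ 𝔞))} {hK : 1 ≤ K} {d n q : ℕ} {X : Fin d → T}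
  {l : Fin n → ℕ} {f : BlockIndex l → K} {a : BlockIndex l → Fin d → T} {c : Fin q → T}

lemma coe_smul_eq (t : T) (y : K) : ((t • y : K) : FractionRing (T ⧸ 𝔞)) =
    algebraMap (T ⧸ 𝔞) (FractionRing (T ⧸ 𝔞)) (Ideal.Quotient.mk 𝔞 t) * y := by
  rw [← Algebra.smul_def]
  change t • (y : FractionRing (T ⧸ 𝔞)) = _
  rw [← Ideal.Quotient.algebraMap_eq, algebraMap_smul]

lemma coe_linearCombination_blockRow (v : Option (BlockIndex l) → T) :
    ((Fintype.linearCombination T (blockRow hK f) v : K) : FractionRing (T ⧸ 𝔞)) =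
      - algebraMap (T ⧸ 𝔞) (FractionRing (T ⧸ 𝔞)) (Ideal.Quotient.mk 𝔞 (v none)) +
        ∑ b, algebraMap (T ⧸ 𝔞) (FractionRing (T ⧸ 𝔞)) (Ideal.Quotient.mk 𝔞 (v (some b))) *
          f b := by
  rw [Fintype.linearCombination_apply, Fintype.sum_option, Submodule.coe_add,
    AddSubmonoidClass.coe_finsetSum, coe_smul_eq]
  simp only [coe_smul_eq, blockRow, Submodule.coe_neg, mul_neg, mul_one]

variable [IsLocalRing T] (hpres : IsMinimalFreePresentation (blockMatrix X a c) (blockRow hK f))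
include hpres

/-- This is ℕ𝕄 = 0 on the column (b, j), with the entry -1 of ℕ moved to the other side. -/
lemma powFirst_mul_eq (b : BlockIndex l) (j : Fin d) :
    algebraMap (T ⧸ 𝔞) (FractionRing (T ⧸ 𝔞)) (Ideal.Quotient.mk 𝔞 (powFirst X (b.1 + 1) j)) *
      f b = algebraMap (T ⧸ 𝔞) (FractionRing (T ⧸ 𝔞)) (Ideal.Quotient.mk 𝔞 (a b j)) := by
  classical
  have h := (hpres.exact ((blockMatrix X a c).mulVecLin (Pi.single (Sum.inl (b, j)) 1))).2 ⟨_, rfl⟩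
  have h2 := congrArg (Subtype.val) h
  rw [coe_linearCombination_blockRow] at h2
  simp only [Matrix.mulVecLin_apply, Matrix.mulVec_single_one, Matrix.col_apply, blockMatrix,
    ZeroMemClass.coe_zero] at h2
  rw [Finset.sum_eq_single b (fun b' _ hb' => by rw [if_neg hb']; simp)
    (fun hb' => absurd (Finset.mem_univ b) hb'), if_pos rfl] at h2
  linear_combination h2

/-- If t f_b = s in R, the vector with s in the first row and t in row b is a syzygy, so it lies in
the image of 𝕄. The only nonzero entries of 𝕄 in row b are the generators of J_k, where k = b.1 + 1.
-/
lemma mem_idealJ_of_mul_mem_one (b : BlockIndex l) {t : T}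
    (ht : algebraMap (T ⧸ 𝔞) (FractionRing (T ⧸ 𝔞)) (Ideal.Quotient.mk 𝔞 t) * f b ∈
      (1 : Submodule (T ⧸ 𝔞) (FractionRing (T ⧸ 𝔞)))) : t ∈ idealJ X (b.1 + 1) := by
  classical
  obtain ⟨s', hs⟩ := Submodule.mem_one.1 ht
  obtain ⟨s, rfl⟩ := Ideal.Quotient.mk_surjective s'
  let v : Option (BlockIndex l) → T := fun o => o.elim s fun b' => if b' = b then t else 0
  have hv : Fintype.linearCombination T (blockRow hK f) v = 0 := by
    apply Subtype.ext
    rw [coe_linearCombination_blockRow, Finset.sum_eq_single b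
      (fun b' _ hb' => by simp [v, hb']) (fun hb' => absurd (Finset.mem_univ b) hb')]
    simp only [v, Option.elim, if_true]
    rw [← hs]
    simp
  obtain ⟨w, hw⟩ := (hpres.exact v).1 hv
  have h2 := congrFun hw (some b)
  rw [Matrix.mulVecLin_apply, Matrix.mulVec, dotProduct, Fintype.sum_sum_type] at h2
  simp only [blockMatrix, zero_mul, Finset.sum_const_zero, add_zero, v, Option.elim,
    if_true] at h2
  rw [← h2]
  refine Ideal.sum_mem _ ?_
  rintro ⟨b', j⟩ -
  dsimp only
  split_ifs with hb
  · exact Ideal.mul_mem_right _ _ (powFirst_mem_idealJ X _ j)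
  · rw [zero_mul]
    exact zero_mem _

/-- It suffices to treat the generators of J_n. For j ≥ 2 the product X_j f_b is an entry a_{bj} ∈
J_n; and X_1^n f_b = X_1^{n-k} a_{b1}, which lies in J_n because a_{b1} ∈ J_k and X_1^{n-k} J_k ⊆
J_n. -/
lemma exists_eq_of_mem_idealJ
    (ha_top : ∀ b : BlockIndex l, (b.1 : ℕ) + 1 = n → ∀ j, a b j ∈ idealJ X n)
    (ha_low : ∀ b : BlockIndex l, (b.1 : ℕ) + 1 < n →
      ∀ j : Fin d, (j : ℕ) ≠ 0 → a b j ∈ idealJ X n)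
    (ha_first : ∀ b : BlockIndex l, (b.1 : ℕ) + 1 < n →
      ∀ j : Fin d, (j : ℕ) = 0 → a b j ∈ idealJ X (b.1 + 1))
    (b : BlockIndex l) {t : T} (ht : t ∈ idealJ X n) :
    ∃ s ∈ idealJ X n,
      algebraMap (T ⧸ 𝔞) (FractionRing (T ⧸ 𝔞)) (Ideal.Quotient.mk 𝔞 t) * f b =
        algebraMap (T ⧸ 𝔞) (FractionRing (T ⧸ 𝔞)) (Ideal.Quotient.mk 𝔞 s) := by
  have hb : (b.1 : ℕ) + 1 ≤ n := b.1.2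
  refine Submodule.span_induction ?_ ⟨0, zero_mem _, by simp⟩ ?_ ?_ ht
  · rintro _ ⟨j, rfl⟩
    have h := powFirst_mul_eq hpres b j
    by_cases hj : (j : ℕ) = 0
    · refine ⟨X j ^ (n - (b.1 + 1)) * a b j, ?_, ?_⟩
      · rcases hb.eq_or_lt with hb' | hb'
        · exact Ideal.mul_mem_left _ _ (ha_top b hb' j)
        · exact pow_mul_mem_idealJ hj hb (ha_first b hb' j hj)
      · rw [powFirst, if_pos hj] at h
        have h2 : powFirst X n j = X j ^ (n - (b.1 + 1)) * X j ^ ((b.1 : ℕ) + 1) := by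
          rw [powFirst, if_pos hj, ← pow_add, Nat.sub_add_cancel hb]
        rw [h2, map_mul, map_mul, mul_assoc, h, ← map_mul, ← map_mul]
    · refine ⟨a b j, ?_, ?_⟩
      · rcases hb.eq_or_lt with hb' | hb'
        · exact ha_top b hb' j
        · exact ha_low b hb' j hj
      · rw [powFirst, if_neg hj] at h ⊢
        exact h
  · rintro y z - - ⟨s, hs, hs'⟩ ⟨t, ht, ht'⟩
    exact ⟨s + t, add_mem hs ht, by simp only [map_add, add_mul, hs', ht']⟩
  · rintro r y - ⟨s, hs, hs'⟩
    refine ⟨r * s, Ideal.mul_mem_left _ _ hs, ?_⟩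
    rw [smul_eq_mul, map_mul, map_mul, map_mul, map_mul, mul_assoc, hs']

lemma mul_mem_fracIdeal_idealJ
    (ha_top : ∀ b : BlockIndex l, (b.1 : ℕ) + 1 = n → ∀ j, a b j ∈ idealJ X n)
    (ha_low : ∀ b : BlockIndex l, (b.1 : ℕ) + 1 < n →
      ∀ j : Fin d, (j : ℕ) ≠ 0 → a b j ∈ idealJ X n)
    (ha_first : ∀ b : BlockIndex l, (b.1 : ℕ) + 1 < n →
      ∀ j : Fin d, (j : ℕ) = 0 → a b j ∈ idealJ X (b.1 + 1))
    {y z : FractionRing (T ⧸ 𝔞)}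
    (hy : y ∈ fracIdeal (FractionRing (T ⧸ 𝔞)) ((idealJ X n).map (Ideal.Quotient.mk 𝔞)))
    (hz : z ∈ K) :
    y * z ∈ fracIdeal (FractionRing (T ⧸ 𝔞)) ((idealJ X n).map (Ideal.Quotient.mk 𝔞)) := by
  obtain ⟨t', ht', rfl⟩ := hy
  obtain ⟨t, ht, rfl⟩ := (Ideal.mem_map_iff_of_surjective _ Ideal.Quotient.mk_surjective).1 ht'
  obtain ⟨v, hv⟩ := hpres.surjective ⟨z, hz⟩
  have hz' := congrArg Subtype.val hv
  rw [coe_linearCombination_blockRow] at hz'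
  change _ = z at hz'
  rw [← hz', mul_add, Finset.mul_sum]
  refine add_mem ?_ (Submodule.sum_mem _ fun b _ => ?_)
  · rw [mul_neg, neg_mem_iff, Algebra.linearMap_apply, ← map_mul]
    exact algebraMap_mem_fracIdeal.2 (Ideal.mul_mem_right _ _ ht')
  · obtain ⟨s, hs, hs'⟩ := exists_eq_of_mem_idealJ hpres ha_top ha_low ha_first b ht
    rw [Algebra.linearMap_apply, mul_left_comm, hs', ← map_mul]
    exact algebraMap_mem_fracIdeal.2 (Ideal.mul_mem_left _ _ (Ideal.mem_map_of_mem _ hs))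

lemma le_idealJ (hl : ∀ k : Fin n, (k : ℕ) + 1 = n → 0 < l k) (hn : n ≠ 0) : 𝔞 ≤ idealJ X n := by
  intro t ht
  -- Exponents are shifted by one: the blocks of exponent n have index n - 1, and one exists since
  -- ℓ_n > 0. For t ∈ 𝔞 the product t f_b is 0 ∈ R.
  have hn' : n - 1 < n := by omega
  have h1 : n - 1 + 1 = n := by omega
  have h := mem_idealJ_of_mul_mem_one hpres
    (⟨⟨n - 1, hn'⟩, ⟨0, hl ⟨n - 1, hn'⟩ h1⟩⟩ : BlockIndex l) (t := t) (by
      rw [Ideal.Quotient.eq_zero_iff_mem.2 ht, map_zero, zero_mul]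
      exact zero_mem _)
  dsimp only at h
  rwa [h1] at h

/-- A multiplier of K into R lies in R since 1 ∈ K, and a block of exponent n then puts it in J_n R.
The converse is J_n K ⊆ J_n R. -/
lemma one_div_eq (hl : ∀ k : Fin n, (k : ℕ) + 1 = n → 0 < l k) (hn : n ≠ 0)
    (ha_top : ∀ b : BlockIndex l, (b.1 : ℕ) + 1 = n → ∀ j, a b j ∈ idealJ X n)
    (ha_low : ∀ b : BlockIndex l, (b.1 : ℕ) + 1 < n →
      ∀ j : Fin d, (j : ℕ) ≠ 0 → a b j ∈ idealJ X n)
    (ha_first : ∀ b : BlockIndex l, (b.1 : ℕ) + 1 < n →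
      ∀ j : Fin d, (j : ℕ) = 0 → a b j ∈ idealJ X (b.1 + 1)) :
    1 / K = fracIdeal (FractionRing (T ⧸ 𝔞)) ((idealJ X n).map (Ideal.Quotient.mk 𝔞)) := by
  apply le_antisymm
  · intro y hy
    rw [Submodule.mem_div_iff_forall_mul_mem] at hy
    have h1 := hy 1 (Submodule.one_le.1 hK)
    rw [mul_one] at h1
    obtain ⟨t', rfl⟩ := Submodule.mem_one.1 h1
    obtain ⟨t, rfl⟩ := Ideal.Quotient.mk_surjective t'
    refine algebraMap_mem_fracIdeal.2 (Ideal.mem_map_of_mem _ ?_)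
    have hn' : n - 1 < n := by omega
    have h1 : n - 1 + 1 = n := by omega
    have h := mem_idealJ_of_mul_mem_one hpres
      (⟨⟨n - 1, hn'⟩, ⟨0, hl ⟨n - 1, hn'⟩ h1⟩⟩ : BlockIndex l) (t := t) (hy _ (f _).2)
    dsimp only at h
    rwa [h1] at h
  · intro y hy
    rw [Submodule.mem_div_iff_forall_mul_mem]
    intro z hz
    exact fracIdeal_le_one _ (mul_mem_fracIdeal_idealJ hpres ha_top ha_low ha_first hy hz)

end BlockPresentation

/-! ### From the fractional canonical ideal K to arbitrary canonical ideals. -/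

section CanonicalIdeals

open scoped nonZeroDivisors

variable {A : Type u} [CommRing A] {Q : Type u} [CommRing Q] [Algebra A Q]

lemma div_mul_eq_div_div (C M N : Submodule A Q) : C / (M * N) = (C / M) / N := by
  apply le_antisymm
  · intro y hy
    simp only [Submodule.mem_div_iff_forall_mul_mem] at hy ⊢
    intro z hz w hw
    rw [mul_right_comm, mul_assoc]
    exact hy _ (Submodule.mul_mem_mul hw hz)
  · rw [Submodule.le_div_iff_mul_le, mul_comm M, ← mul_assoc, ← Submodule.le_div_iff_mul_le,
      ← Submodule.le_div_iff_mul_le]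

lemma fracIdeal_mul (I J : Ideal A) : fracIdeal Q (I * J) = fracIdeal Q I * fracIdeal Q J :=
  Submodule.map_mul I J (Algebra.ofId A Q)

lemma fracIdeal_span_singleton (x : A) :
    fracIdeal Q (Ideal.span {x}) = Submodule.span A {algebraMap A Q x} := by
  change Submodule.map _ (Submodule.span A {x}) = _
  rw [Submodule.map_span, Set.image_singleton]
  rfl

lemma exists_mem_nonZeroDivisors_of_isCohenMacaulayLocal [IsLocalRing A]
    (h : IsCohenMacaulayLocal A) (hdim : ringKrullDim A = 1) :
    ∃ s ∈ A⁰, s ∈ maximalIdeal A := by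
  obtain ⟨-, rs, h1, h2, h3⟩ := h
  rw [hdim] at h3
  have h4 : rs.length = 1 := by exact_mod_cast h3
  obtain ⟨s, rfl⟩ := List.length_eq_one_iff.1 h4
  refine ⟨s, ?_, h1 s (List.mem_singleton_self s)⟩
  have h5 : IsSMulRegular A s :=
    ((RingTheory.Sequence.isWeaklyRegular_cons_iff A s []).1 h2.toIsWeaklyRegular).1
  refine mem_nonZeroDivisors_iff_right.2 fun y hy => h5 ?_
  change s * y = s * 0
  rw [mul_comm, hy, mul_zero]

variable [IsFractionRing A Q]

lemma fracIdeal_injective {I J : Ideal A} (h : fracIdeal Q I = fracIdeal Q J) : I = J :=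
  Submodule.map_injective_of_injective (IsFractionRing.injective A Q) h

/-- The extra factor s ∈ 𝔪 in the embedding K → A makes the image a proper ideal. -/
lemma exists_isCanonicalIdeal [IsLocalRing A] {s : A} (hs : s ∈ A⁰) (hsm : s ∈ maximalIdeal A)
    {K : Submodule A Q} (hK : IsCanonicalModule A K) (hKr : IsRegularFractional K) :
    ∃ I : Ideal A, IsCanonicalIdeal I := by
  obtain ⟨a, ha, f, hf, -⟩ := hKr.exists_linearMap
  have hg : Function.Injective (s • f) := by
    intro y z hyz
    refine hf (sub_eq_zero.1 (mem_nonZeroDivisors_iff_left.1 hs _ ?_))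
    rw [mul_sub]
    exact sub_eq_zero.2 hyz
  refine ⟨LinearMap.range (s • f), fun h => ?_, hK.congr (LinearEquiv.ofInjective _ hg)⟩
  have h1 : (1 : A) ∈ LinearMap.range (s • f) := h ▸ Submodule.mem_top
  obtain ⟨y, hy⟩ := h1
  refine (Ideal.ne_top_iff_one _).1 (maximalIdeal.isMaximal A).ne_top (hy ▸ ?_)
  exact Ideal.mul_mem_right _ _ hsm

/-- The `n`-Goto property relative to a canonical ideal `I`, from the corresponding properties of a
fractional canonical ideal `K`. -/
lemma isGotoRelativeTo_of_fractional [IsLocalRing A] [IsNoetherianRing A]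
    (hdim : ringKrullDim A = 1) {s : A} (hs : s ∈ A⁰) (hsm : s ∈ maximalIdeal A)
    {K : Submodule A Q} (hK1 : 1 ≤ K) (hK : IsCanonicalModule A K) (hKr : IsRegularFractional K)
    (hKKK : K * K * K = K * K) {n : ℕ}
    (hn : Module.length A (↥(K * K) ⧸ K.submoduleOf (K * K)) = n)
    {I : Ideal A} (hI : IsCanonicalIdeal I) : IsGotoRelativeTo A n I := by
  obtain ⟨t, htI, ht⟩ := exists_mem_nonZeroDivisors_of_isCanonicalModule hdim hs hsm hI.2
  obtain ⟨z, hz⟩ := exists_unit_of_isCanonicalModule hdim hs hsm hK hKr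
    (hI.2.congr (fracIdealEquiv Q I)) (IsRegularFractional.fracIdeal ht htI)
  -- Since I = z⁻¹K and 1 ∈ K, the element x = z⁻¹ lies in I; it is the regular element with I = xK
  -- which generates Q.
  have hzinv : ((z⁻¹ : Qˣ) : Q) ∈ fracIdeal Q I := by
    rw [hz, Units.inv_mul]
    exact Submodule.one_le.1 hK1
  obtain ⟨x, hxI, hx⟩ := mem_fracIdeal.1 hzinv
  have hx0 : x ∈ A⁰ := by
    refine mem_nonZeroDivisors_iff_right.2 fun y hy => ?_
    have h1 := congrArg (algebraMap A Q) hy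
    rw [map_mul, hx, map_zero, Units.mul_left_eq_zero] at h1
    exact (IsFractionRing.to_map_eq_zero_iff).1 h1
  have hxm : x ∈ maximalIdeal A := IsLocalRing.le_maximalIdeal hI.1 hxI
  have hspan {M : Submodule A Q} {y : Q} :
      y ∈ Submodule.span A {algebraMap A Q x} * M ↔ y * z ∈ M := by
    rw [Submodule.mem_span_singleton_mul, hx]
    refine ⟨?_, fun h => ⟨y * z, h, by rw [mul_comm, mul_assoc, Units.mul_inv, mul_one]⟩⟩
    rintro ⟨w, hw, rfl⟩
    rwa [mul_right_comm, Units.inv_mul, one_mul]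
  have hIK : fracIdeal Q I = Submodule.span A {algebraMap A Q x} * K :=
    Submodule.ext fun y => (hz y).trans hspan.symm
  have hI2 : fracIdeal Q (I ^ 2) = Submodule.span A {algebraMap A Q x} *
      (Submodule.span A {algebraMap A Q x} * (K * K)) := by
    rw [pow_two, fracIdeal_mul, hIK]
    ring
  have hI3 : I ^ 3 = Ideal.span {x} * I ^ 2 := by
    apply fracIdeal_injective (Q := Q)
    rw [fracIdeal_mul, hI2, fracIdeal_span_singleton, ← hKKK, pow_succ, pow_two, fracIdeal_mul,
      fracIdeal_mul, hIK]
    ring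
  have hxI' : fracIdeal Q (Ideal.span {x} * I) = Submodule.span A {algebraMap A Q x} *
      (Submodule.span A {algebraMap A Q x} * K) := by
    rw [fracIdeal_mul, fracIdeal_span_singleton, hIK]
  have hlen : Module.length A (↥(I ^ 2) ⧸ (Ideal.span {x} * I).submoduleOf (I ^ 2)) = n := by
    rw [← hn]
    have hmem (y : ↥(I ^ 2)) : algebraMap A Q y * z * z ∈ K * K :=
      hspan.1 (hspan.1 (hI2 ▸ algebraMap_mem_fracIdeal.2 y.2))
    -- Multiplication by z² carries I² = x²K² onto K² and xI = x²K onto K.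
    let g : ↥(I ^ 2) →ₗ[A] ↥(K * K) :=
      { toFun := fun y => ⟨algebraMap A Q y * z * z, hmem y⟩
        map_add' := fun y w => Subtype.ext (by simp [add_mul])
        map_smul' := fun r y => Subtype.ext (by simp [Algebra.smul_def, mul_assoc]) }
    have hg : Function.Surjective ((K.submoduleOf (K * K)).mkQ ∘ₗ g) := by
      refine (Submodule.mkQ_surjective _).comp fun w => ?_
      have h1 : (w : Q) * (z⁻¹ : Qˣ) * (z⁻¹ : Qˣ) ∈ fracIdeal Q (I ^ 2) := by
        rw [hI2, hspan, hspan, Units.inv_mul_cancel_right, Units.inv_mul_cancel_right]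
        exact w.2
      obtain ⟨y, hy, hyw⟩ := mem_fracIdeal.1 h1
      refine ⟨⟨y, hy⟩, Subtype.ext ?_⟩
      change algebraMap A Q y * z * z = w
      rw [hyw, Units.inv_mul_cancel_right, Units.inv_mul_cancel_right]
    have hker : (Ideal.span {x} * I).submoduleOf (I ^ 2) =
        LinearMap.ker ((K.submoduleOf (K * K)).mkQ ∘ₗ g) := by
      ext y
      rw [LinearMap.mem_ker, LinearMap.comp_apply, Submodule.mkQ_apply,
        Submodule.Quotient.mk_eq_zero]
      change (y : A) ∈ Ideal.span {x} * I ↔ algebraMap A Q y * z * z ∈ K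
      rw [← algebraMap_mem_fracIdeal (Q := Q) (N := Ideal.span {x} * I), hxI', hspan, hspan]
    have h := (LinearMap.quotKerEquivOfSurjective _ hg).length_eq
    rwa [← hker] at h
  have hrange : Ideal.span (Set.range fun _ : Fin (0 + 1) => x) = Ideal.span {x} := by
    rw [Set.range_const]
  have hsup : I ⊔ Ideal.span {x} = I := sup_eq_left.2 ((Ideal.span_singleton_le_iff_mem I).2 hxI)
  refine ⟨0, fun _ => x, ⟨?_, ?_⟩, hxI, ?_, ?_⟩
  · rw [hdim]
    rfl
  · rw [hrange]
    exact radical_span_singleton hdim hx0 hxm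
  · rw [hrange, hsup]
    exact sallyRankEq_of_pow_eq hxI hx0 hI3 hlen
  · rw [hrange, hsup]
    exact sallyGeneratedInDegreeOne_of_pow_eq hxI hI3

/-- If `A : K` is an `A[K]`-module, then `K³ = K²` and `ℓ(K²/K) = ℓ(A/(A : K))`. -/
lemma mul_mul_self_eq_and_length [IsLocalRing A] [IsNoetherianRing A]
    (hdim : ringKrullDim A = 1) {K : Submodule A Q} (hK1 : 1 ≤ K) (hK : IsCanonicalModule A K)
    (hKr : IsRegularFractional K) {N : Ideal A} (h1 : 1 / K = fracIdeal Q N)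
    (h2 : ∀ y ∈ fracIdeal Q N, ∀ z ∈ K, y * z ∈ fracIdeal Q N) :
    K * K * K = K * K ∧
      Module.length A (↥(K * K) ⧸ K.submoduleOf (K * K)) = Module.length A (A ⧸ N) := by
  -- Reflexivity of A, whose dual K : A is K.
  have hKK : K / K = 1 := by
    have h := div_div_self hdim hK hKr (IsRegularFractional.one (A := A) (Q := Q))
    rwa [div_one_eq] at h
  have hdiv2 : K / (K * K) = fracIdeal Q N := by rw [div_mul_eq_div_div, hKK, h1]
  have hdiv3 : K / (K * K * K) = fracIdeal Q N := by
    rw [div_mul_eq_div_div, hdiv2]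
    apply le_antisymm
    · intro y hy
      have := Submodule.mem_div_iff_forall_mul_mem.1 hy 1 (Submodule.one_le.1 hK1)
      rwa [mul_one] at this
    · exact Submodule.le_div_iff.2 h2
  have hr2 := hKr.mul hKr
  have hrefl := div_div_self hdim hK hKr hr2
  refine ⟨?_, ?_⟩
  · rw [← div_div_self hdim hK hKr (hr2.mul hKr), hdiv3, ← hdiv2, hrefl]
  · have hNr : IsRegularFractional (fracIdeal Q N) := h1 ▸ IsRegularFractional.one.div hKr
    -- Duality applied to N ⊆ A, with K : A = K and K : N = K².
    have h := length_div_quotient hdim hK (fracIdeal_le_one N) hNr IsRegularFractional.one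
    rwa [length_one_quotient_fracIdeal, div_one_eq, ← hdiv2, hrefl] at h

end CanonicalIdeals
end GotoRing
end

/-! ### Assembly: the structure of R/𝔠 and the conclusion. -/

theorem theorem10p9 {T : Type u} [CommRing T] [IsRegularLocalRing T]
    (d : ℕ) (hd : 3 ≤ d) (hdim : ringKrullDim T = d)
    (𝔞 : Ideal T) [IsLocalRing (T ⧸ 𝔞)]
    (hCM : GotoRing.IsCohenMacaulayLocal (T ⧸ 𝔞)) (hR : ringKrullDim (T ⧸ 𝔞) = 1)
    (hG : ¬ GotoRing.IsGorensteinLocal (T ⧸ 𝔞))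
    (K : Submodule (T ⧸ 𝔞) (FractionRing (T ⧸ 𝔞)))
    (hK : GotoRing.IsFractionalCanonicalIdeal (T ⧸ 𝔞) K)
    (r : ℕ) (hr : GotoRing.HasCMType (T ⧸ 𝔞) r)
    (n : ℕ) (hn : 2 ≤ n)
    (X : Fin d → T) (hX : Ideal.span (Set.range X) = IsLocalRing.maximalIdeal T)
    (h𝔞 : 𝔞 ≤ IsLocalRing.maximalIdeal T ^ 2)
    (l : Fin n → ℕ) (hl : ∀ k : Fin n, (k : ℕ) + 1 = n → 0 < l k)
    (hlr : ∑ k, l k + 1 = r)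
    (f : GotoRing.BlockIndex l → K)
    (q : ℕ) (a : GotoRing.BlockIndex l → Fin d → T) (c : Fin q → T)
    (hpres : GotoRing.IsMinimalFreePresentation
      (GotoRing.blockMatrix X a c) (GotoRing.blockRow hK.1 f))
    (ha_top : ∀ b : GotoRing.BlockIndex l, (b.1 : ℕ) + 1 = n →
      ∀ j, a b j ∈ GotoRing.idealJ X n)
    (ha_low : ∀ b : GotoRing.BlockIndex l, (b.1 : ℕ) + 1 < n →
      ∀ j : Fin d, (j : ℕ) ≠ 0 → a b j ∈ GotoRing.idealJ X n)
    (ha_first : ∀ b : GotoRing.BlockIndex l, (b.1 : ℕ) + 1 < n →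
      ∀ j : Fin d, (j : ℕ) = 0 → a b j ∈ GotoRing.idealJ X (b.1 + 1)) :
    GotoRing.IsGotoRing (T ⧸ 𝔞) n ∧
      ∃ _ : IsLocalRing ((T ⧸ 𝔞) ⧸ GotoRing.conductorOf K),
        GotoRing.embeddingDim ((T ⧸ 𝔞) ⧸ GotoRing.conductorOf K) = 1 := by
  have hn0 : n ≠ 0 := by omega
  let j₀ : Fin d := ⟨0, by omega⟩
  have hj₀ : (j₀ : ℕ) = 0 := rfl
  have hKr := GotoRing.IsRegularFractional.of_fg (Module.Finite.iff_fg.1 hK.2.2.1) hK.1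
  obtain ⟨s, hs, hsm⟩ := GotoRing.exists_mem_nonZeroDivisors_of_isCohenMacaulayLocal hCM hR
  have h1 := GotoRing.one_div_eq hpres hl hn0 ha_top ha_low ha_first
  have h2 : ∀ y ∈ GotoRing.fracIdeal (FractionRing (T ⧸ 𝔞))
      ((GotoRing.idealJ X n).map (Ideal.Quotient.mk 𝔞)), ∀ z ∈ K, y * z ∈ _ := fun y hy z hz =>
    GotoRing.mul_mem_fracIdeal_idealJ hpres ha_top ha_low ha_first hy hz
  have hcond := GotoRing.conductorOf_eq h1 h2
  obtain ⟨hK3, hlen⟩ := GotoRing.mul_mul_self_eq_and_length hR hK.1 hK.2.2 hKr h1 h2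
  rw [← hcond] at hlen
  -- The kernel of T → R/𝔠 is exactly J_n, and not only J_n + 𝔞, because 𝔞 ⊆ J_n.
  have hmemJ (t : T) : Ideal.Quotient.mk _ (Ideal.Quotient.mk 𝔞 t) =
      (0 : (T ⧸ 𝔞) ⧸ GotoRing.conductorOf K) ↔ t ∈ GotoRing.idealJ X n := by
    rw [Ideal.Quotient.eq_zero_iff_mem, hcond,
      Ideal.mem_map_iff_of_surjective _ Ideal.Quotient.mk_surjective]
    refine ⟨?_, fun h => ⟨t, h, rfl⟩⟩
    rintro ⟨t', ht', htt⟩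
    rw [← sub_sub_cancel t' t]
    exact sub_mem ht' (GotoRing.le_idealJ hpres hl hn0 (Ideal.Quotient.eq.1 htt))
  let π : T →+* (T ⧸ 𝔞) ⧸ GotoRing.conductorOf K :=
    (Ideal.Quotient.mk (GotoRing.conductorOf K)).comp (Ideal.Quotient.mk 𝔞)
  have hπ : Function.Surjective π :=
    Ideal.Quotient.mk_surjective.comp Ideal.Quotient.mk_surjective
  have hpow {m : ℕ} (hm : m < n) : π (X j₀) ^ m ≠ 0 := by
    rw [← map_pow]
    exact fun h => GotoRing.pow_notMem_idealJ hdim hX hj₀ hm ((hmemJ _).1 h)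
  have hnt : Nontrivial ((T ⧸ 𝔞) ⧸ GotoRing.conductorOf K) :=
    ⟨_, _, hpow (show 0 < n by omega)⟩
  have hloc : IsLocalRing ((T ⧸ 𝔞) ⧸ GotoRing.conductorOf K) :=
    IsLocalRing.of_surjective' _ Ideal.Quotient.mk_surjective
  have hmax : maximalIdeal ((T ⧸ 𝔞) ⧸ GotoRing.conductorOf K) = Ideal.span {π (X j₀)} := by
    have h3 : (maximalIdeal T).map π = maximalIdeal ((T ⧸ 𝔞) ⧸ GotoRing.conductorOf K) :=
      IsLocalRing.map_maximalIdeal_of_surjective π hπ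
    have h4 : (GotoRing.idealJ X n).map π = ⊥ :=
      (Ideal.map_eq_bot_iff_le_ker π).2 fun t ht => (hmemJ t).2 ht
    rw [← h3, GotoRing.maximalIdeal_eq_sup_span hX hj₀ hn0, Ideal.map_sup, h4, bot_sup_eq,
      Ideal.map_span, Set.image_singleton]
  have hzero : π (X j₀) ^ n = 0 := by
    rw [← map_pow]
    exact (hmemJ _).2 (GotoRing.pow_mem_idealJ hj₀)
  -- Lengths over R and over its quotient R/𝔠 agree, and R/𝔠 is a chain ring of length n.
  have hlen' : Module.length (T ⧸ 𝔞) ((T ⧸ 𝔞) ⧸ GotoRing.conductorOf K) = n :=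
    (Module.length_eq_of_surjective (R := (T ⧸ 𝔞) ⧸ GotoRing.conductorOf K)
      Ideal.Quotient.mk_surjective).trans
      (GotoRing.length_eq_of_maximalIdeal_eq_span hmax hzero fun m hm => hpow hm)
  rw [hlen'] at hlen
  refine ⟨⟨hCM, GotoRing.exists_isCanonicalIdeal hs hsm hK.2.2 hKr, fun I hI =>
    GotoRing.isGotoRelativeTo_of_fractional hR hs hsm hK.1 hK.2.2 hKr hK3 hlen hI⟩, hloc, ?_⟩
  rw [GotoRing.embeddingDim, hmax]
  -- Here n ≥ 2 is essential: it keeps the generator of the maximal ideal of R/𝔠 nonzero.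
  have hne := hpow (show 1 < n by omega)
  rw [pow_one] at hne
  exact Submodule.spanFinrank_singleton hne
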